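/- **Setting.** Let $(\Omega,\mathcal F,\mathbb P)$ be a probability space with a filtration $\{\mathcal F_t\}_{t=0}^T$, $\mathcal F_0=\{\emptyset,\Omega\}$. There are a risk-free asset with deterministic gross returns $r^0_{t+1}>0$ ($t=0,\dots,T-1$) and $N$ risky assets with excess returns $\mathbf r_t=\mathbf f(t,\mathbf s_t,\boldsymbol\epsilon_t)\in\mathbb R^N$, where the state variables $\mathbf s_t\in\mathbb R^{N_s}$ satisfy $\mathbf s_t=\mathbf g(t,\mathbf s_{t-1},\boldsymbol\xi_t)$, $t=1,\dots,T$, with $\mathbf s_0$ deterministic; $\boldsymbol\epsilon_t,\boldsymbol\xi_t,\mathbf r_t,\mathbf s_t$ are $\mathcal F_t$-measurable, and for each $t<T$ the conditional law of $(\mathbf r_{t+1},\mathbf s_{t+1})$ given $\mathcal F_t$ coincides with its conditional law given $\mathbf s_t$. Assume that, for each $t<T$ and almost surely, $\mathbf r_{t+1}$ has finite second moments conditionally on $\mathbf s_t$ and $\mathrm{Cov}[\mathbf r_{t+1}\mid\mathbf s_t]\succ0$. Let $\mathcal A_t\subseteq\mathbb R^N$ ($t<T$) be deterministic, not necessarily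 convex, cones ($0\in\mathcal A_t$, and $\alpha\mathbf k\in\mathcal A_t$ for $\alpha>0$, $\mathbf k\in\mathcal A_t$). A portfolio process $\boldsymbol\pi=(\boldsymbol\pi_t)_{t<T}$ is admissible if $\boldsymbol\pi_t$ is $\mathcal F_t$-measurable, $\boldsymbol\pi_t\in\mathcal A_t$ almost surely, and the wealth $x_{t+1}=r^0_{t+1}x_t+\mathbf r_{t+1}^\top\boldsymbol\pi_t$ started at $x_0\in\mathbb R$ has $\mathrm E[x_T^2]<\infty$. For $\lambda\ge0$ the problem $\mathcal P^1_{\mathrm{mv}}(\lambda)$ is to minimize $\mathrm{Var}[x_T]-2\lambda\,\mathrm E[x_T]$ over admissible portfolio processes. The efficient frontier is the set of pairs $(\mathrm E[x_T],\mathrm{Var}[x_T])$ of admissible processes that are not dominated by another such pair with mean at least as large and variance at most as large. Put $\rho_t=\prod_{k=t}^{T-1}r^0_{k+1}$, $\rho_T=1$. Define $d_T^\pm=1$ and, for $t=T-1,\dots,0$, $$d_t^-(\mathbf s_t)=\inf_{\mathbf k\in\mathcal A_t}\mathrm E\big[(1-\mathbf r_{t+1}^\top\mathbf k)^2\big(d_{t+1}^-(\mathbf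 s_{t+1})\mathbb 1_{\{\mathbf r_{t+1}^\top\mathbf k\le1\}}+d_{t+1}^+(\mathbf s_{t+1})\mathbb 1_{\{\mathbf r_{t+1}^\top\mathbf k>1\}}\big)\,\big|\,\mathbf s_t\big],$$ $$d_t^+(\mathbf s_t)=\inf_{\mathbf k\in\mathcal A_t}\mathrm E\big[(1+\mathbf r_{t+1}^\top\mathbf k)^2\big(d_{t+1}^+(\mathbf s_{t+1})\mathbb 1_{\{\mathbf r_{t+1}^\top\mathbf k\ge-1\}}+d_{t+1}^-(\mathbf s_{t+1})\mathbb 1_{\{\mathbf r_{t+1}^\top\mathbf k<-1\}}\big)\,\big|\,\mathbf s_t\big],$$ where the conditional expectations are integrals against the regular conditional law of $(\mathbf r_{t+1},\mathbf s_{t+1})$ given $\mathbf s_t$. Let $\mathbf k_t^-(\cdot)$ and $\mathbf k_t^+(\cdot)$ denote measurable functions of the state which, for almost every value of $\mathbf s_t$, are minimizers over $\mathcal A_t$ of the problems defining $d_t^-$ and $d_t^+$ respectively. **Theorem.** If all $\mathcal A_t$ are closed, such minimizers $\mathbf k_t^\pm$ exist. For every choice of such minimizers, with $d_0^-=d_0^-(\mathbf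 s_0)$, one has $0<d_0^-\le1$, and the feedback policy $$\boldsymbol\pi_t^*(x_t,\mathbf s_t)=-\mathbf k_t^-(\mathbf s_t)\Big(r^0_{t+1}x_t-\frac{\rho_0x_0d_0^-+\lambda}{\rho_{t+1}d_0^-}\Big)\mathbb 1_{\{\rho_tx_t\le\rho_0x_0+\lambda/d_0^-\}}+\mathbf k_t^+(\mathbf s_t)\Big(r^0_{t+1}x_t-\frac{\rho_0x_0d_0^-+\lambda}{\rho_{t+1}d_0^-}\Big)\mathbb 1_{\{\rho_tx_t>\rho_0x_0+\lambda/d_0^-\}},$$ $t=0,\dots,T-1$, is admissible and optimal for $\mathcal P^1_{\mathrm{mv}}(\lambda)$. Its terminal wealth $x_T^*$ satisfies $$\mathrm E[x_T^*]=\rho_0x_0+\lambda\Big(\frac1{d_0^-}-1\Big),\qquad \mathrm{Var}[x_T^*]=\lambda^2\Big(\frac1{d_0^-}-1\Big),$$ and the pair $(\mathrm E[x_T^*],\mathrm{Var}[x_T^*])$ lies on the efficient frontier. If $d_0^-<1$, then $\mathrm E[x_T^*]\ge\rho_0x_0$ and $$\mathrm{Var}[x_T^*]=\frac{d_0^-\,(\mathrm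 E[x_T^*]-\rho_0x_0)^2}{1-d_0^-},$$ and the efficient frontier is exactly the curve $\{(m,v): m\ge\rho_0x_0,\ v=d_0^-(m-\rho_0x_0)^2/(1-d_0^-)\}$. -/

import Mathlib

open MeasureTheory ProbabilityTheory
open scoped Matrix

noncomputable section

namespace MeanVariance

/-- A market with one risk-free asset and `N` risky assets over the periods `0, …, T`, driven by
`Ns`-dimensional observable state variables. -/
structure FactorMarket {Ω : Type*} [mΩ : MeasurableSpace Ω] (μ : Measure Ω)
    (T N Ns Nξ : ℕ) where
  /-- information available at each time -/
  ℱ : Filtration ℕ mΩ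
  /-- `r0 t` is the (gross) risk-free return realised at time `t` -/
  r0 : ℕ → ℝ
  /-- factor model of the excess returns -/
  f : ℕ → (Fin Ns → ℝ) → (Fin N → ℝ) → (Fin N → ℝ)
  /-- dynamics of the state variables -/
  g : ℕ → (Fin Ns → ℝ) → (Fin Nξ → ℝ) → (Fin Ns → ℝ)
  /-- noise in the returns -/
  ε : ℕ → Ω → (Fin N → ℝ)
  /-- noise in the states -/
  ξ : ℕ → Ω → (Fin Nξ → ℝ)
  /-- excess returns of the risky assets; `r t` is realised at time `t` -/
  r : ℕ → Ω → (Fin N → ℝ)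
  /-- state variables -/
  s : ℕ → Ω → (Fin Ns → ℝ)
  /-- initial state -/
  s₀ : Fin Ns → ℝ
  ℱ_zero : ℱ 0 = ⊥
  r0_pos : ∀ t < T, 0 < r0 (t + 1)
  s_zero : ∀ ω, s 0 ω = s₀
  r_eq : ∀ t < T, ∀ ω, r (t + 1) ω = f (t + 1) (s (t + 1) ω) (ε (t + 1) ω)
  s_eq : ∀ t < T, ∀ ω, s (t + 1) ω = g (t + 1) (s t ω) (ξ (t + 1) ω)
  ε_meas : ∀ t < T, Measurable[ℱ (t + 1)] (ε (t + 1))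
  ξ_meas : ∀ t < T, Measurable[ℱ (t + 1)] (ξ (t + 1))
  r_meas : ∀ t < T, Measurable[ℱ (t + 1)] (r (t + 1))
  s_meas : ∀ t ≤ T, Measurable[ℱ t] (s t)
  /-- conditioning next period's return and state on the whole information at time `t` is the
  same as conditioning on the state variables at time `t` -/
  markov : ∀ t < T, ∀ B : Set ((Fin N → ℝ) × (Fin Ns → ℝ)), MeasurableSet B →
    μ[((fun ω => (r (t + 1) ω, s (t + 1) ω)) ⁻¹' B).indicator (fun _ => (1 : ℝ)) | ℱ t]
      =ᵐ[μ]
    μ[((fun ω => (r (t + 1) ω, s (t + 1) ω)) ⁻¹' B).indicator (fun _ => (1 : ℝ)) |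
      MeasurableSpace.comap (s t) inferInstance]

/-- `E[(1 - rᵀk)² (d⁻(s) 1{rᵀk ≤ 1} + d⁺(s) 1{rᵀk > 1})]` for `(r, s)` with law `ν`. -/
def lossMinus {N Ns : ℕ} (ν : Measure ((Fin N → ℝ) × (Fin Ns → ℝ)))
    (dm dp : (Fin Ns → ℝ) → ℝ) (k : Fin N → ℝ) : ℝ :=
  ∫ p, (1 - p.1 ⬝ᵥ k) ^ 2 * (if p.1 ⬝ᵥ k ≤ 1 then dm p.2 else dp p.2) ∂ν

/-- `E[(1 + rᵀk)² (d⁺(s) 1{rᵀk ≥ -1} + d⁻(s) 1{rᵀk < -1})]` for `(r, s)` with law `ν`. -/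
def lossPlus {N Ns : ℕ} (ν : Measure ((Fin N → ℝ) × (Fin Ns → ℝ)))
    (dm dp : (Fin Ns → ℝ) → ℝ) (k : Fin N → ℝ) : ℝ :=
  ∫ p, (1 + p.1 ⬝ᵥ k) ^ 2 * (if -1 ≤ p.1 ⬝ᵥ k then dp p.2 else dm p.2) ∂ν

namespace FactorMarket

variable {Ω : Type*} [MeasurableSpace Ω] {μ : Measure Ω} {T N Ns Nξ : ℕ}

/-- Cumulative risk-free return from time `t` to time `T`. -/
def rho (M : FactorMarket μ T N Ns Nξ) (t : ℕ) : ℝ :=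
  ∏ k ∈ Finset.Ico t T, M.r0 (k + 1)

/-- Conditional law of `(r_{t+1}, s_{t+1})` given the value of `s_t`. -/
def transition [IsFiniteMeasure μ] (M : FactorMarket μ T N Ns Nξ) (t : ℕ) :
    Kernel (Fin Ns → ℝ) ((Fin N → ℝ) × (Fin Ns → ℝ)) :=
  condDistrib (fun ω => (M.r (t + 1) ω, M.s (t + 1) ω)) (M.s t) μ

/-- Conditional covariance matrix of `r_{t+1}` given `s_t = σ`. -/
def condCov [IsFiniteMeasure μ] (M : FactorMarket μ T N Ns Nξ) (t : ℕ) (σ : Fin Ns → ℝ) :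
    Matrix (Fin N) (Fin N) ℝ :=
  Matrix.of fun i j => covariance (fun p => p.1 i) (fun p => p.1 j) (M.transition t σ)

/-- Given the state variables, the excess returns of the next period have finite second moments
and a positive definite covariance matrix. -/
def NondegenerateReturns [IsFiniteMeasure μ] (M : FactorMarket μ T N Ns Nξ) : Prop :=
  ∀ t < T, ∀ᵐ σ ∂(μ.map (M.s t)),
    (∀ i, MemLp (fun p : (Fin N → ℝ) × (Fin Ns → ℝ) => p.1 i) 2 (M.transition t σ)) ∧
      (M.condCov t σ).PosDef

/-- The pair `(d⁻, d⁺)` when `n` periods remain, that is, at time `T - n`. -/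
def fio [IsFiniteMeasure μ] (M : FactorMarket μ T N Ns Nξ) (A : ℕ → Set (Fin N → ℝ)) :
    ℕ → ((Fin Ns → ℝ) → ℝ) × ((Fin Ns → ℝ) → ℝ)
  | 0 => (fun _ => 1, fun _ => 1)
  | n + 1 =>
    (fun σ => sInf
        (lossMinus (M.transition (T - (n + 1)) σ) (M.fio A n).1 (M.fio A n).2 '' A (T - (n + 1))),
      fun σ => sInf
        (lossPlus (M.transition (T - (n + 1)) σ) (M.fio A n).1 (M.fio A n).2 '' A (T - (n + 1))))

/-- `d_t⁻`. -/
def dMinus [IsFiniteMeasure μ] (M : FactorMarket μ T N Ns Nξ) (A : ℕ → Set (Fin N → ℝ))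
    (t : ℕ) : (Fin Ns → ℝ) → ℝ := (M.fio A (T - t)).1

/-- `d_t⁺`. -/
def dPlus [IsFiniteMeasure μ] (M : FactorMarket μ T N Ns Nξ) (A : ℕ → Set (Fin N → ℝ))
    (t : ℕ) : (Fin Ns → ℝ) → ℝ := (M.fio A (T - t)).2

/-- `h_t⁻(k; σ)`, the objective whose infimum over `A t` is `d_t⁻(σ)`. -/
def hMinus [IsFiniteMeasure μ] (M : FactorMarket μ T N Ns Nξ) (A : ℕ → Set (Fin N → ℝ))
    (t : ℕ) (σ : Fin Ns → ℝ) (k : Fin N → ℝ) : ℝ :=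
  lossMinus (M.transition t σ) (M.dMinus A (t + 1)) (M.dPlus A (t + 1)) k

/-- `h_t⁺(k; σ)`, the objective whose infimum over `A t` is `d_t⁺(σ)`. -/
def hPlus [IsFiniteMeasure μ] (M : FactorMarket μ T N Ns Nξ) (A : ℕ → Set (Fin N → ℝ))
    (t : ℕ) (σ : Fin Ns → ℝ) (k : Fin N → ℝ) : ℝ :=
  lossPlus (M.transition t σ) (M.dMinus A (t + 1)) (M.dPlus A (t + 1)) k

theorem dMinus_terminal [IsFiniteMeasure μ] (M : FactorMarket μ T N Ns Nξ)
    (A : ℕ → Set (Fin N → ℝ)) (σ : Fin Ns → ℝ) : M.dMinus A T σ = 1 := by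
  simp [dMinus, fio]

theorem dPlus_terminal [IsFiniteMeasure μ] (M : FactorMarket μ T N Ns Nξ)
    (A : ℕ → Set (Fin N → ℝ)) (σ : Fin Ns → ℝ) : M.dPlus A T σ = 1 := by
  simp [dPlus, fio]

theorem dMinus_eq [IsFiniteMeasure μ] (M : FactorMarket μ T N Ns Nξ)
    (A : ℕ → Set (Fin N → ℝ)) {t : ℕ} (ht : t < T) (σ : Fin Ns → ℝ) :
    M.dMinus A t σ = sInf (M.hMinus A t σ '' A t) := by
  obtain ⟨n, rfl⟩ := Nat.exists_eq_add_of_lt ht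
  have h1 : t + n + 1 - t = n + 1 := by omega
  have h2 : t + n + 1 - (t + 1) = n := by omega
  have h3 : t + n + 1 - (n + 1) = t := by omega
  have h : M.hMinus A t σ = lossMinus (M.transition t σ) (M.fio A n).1 (M.fio A n).2 := by
    funext k
    simp only [hMinus, dMinus, dPlus, h2]
  rw [h]
  simp only [dMinus, h1, fio, h3]

theorem dPlus_eq [IsFiniteMeasure μ] (M : FactorMarket μ T N Ns Nξ)
    (A : ℕ → Set (Fin N → ℝ)) {t : ℕ} (ht : t < T) (σ : Fin Ns → ℝ) :
    M.dPlus A t σ = sInf (M.hPlus A t σ '' A t) := by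
  obtain ⟨n, rfl⟩ := Nat.exists_eq_add_of_lt ht
  have h1 : t + n + 1 - t = n + 1 := by omega
  have h2 : t + n + 1 - (t + 1) = n := by omega
  have h3 : t + n + 1 - (n + 1) = t := by omega
  have h : M.hPlus A t σ = lossPlus (M.transition t σ) (M.fio A n).1 (M.fio A n).2 := by
    funext k
    simp only [hPlus, dMinus, dPlus, h2]
  rw [h]
  simp only [dPlus, h1, fio, h3]

/-- `km t`, `kp t` are measurable functions of the state that minimise `h_t⁻`, `h_t⁺` over the
cone `A t`, for almost every value of the state. -/
def IsAllocation [IsFiniteMeasure μ] (M : FactorMarket μ T N Ns Nξ)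
    (A : ℕ → Set (Fin N → ℝ)) (km kp : ℕ → (Fin Ns → ℝ) → (Fin N → ℝ)) : Prop :=
  ∀ t < T, Measurable (km t) ∧ Measurable (kp t) ∧
    ∀ᵐ σ ∂(μ.map (M.s t)),
      (km t σ ∈ A t ∧ ∀ k ∈ A t, M.hMinus A t σ (km t σ) ≤ M.hMinus A t σ k) ∧
      (kp t σ ∈ A t ∧ ∀ k ∈ A t, M.hPlus A t σ (kp t σ) ≤ M.hPlus A t σ k)

/-- Wealth process of the portfolio process `π` from the initial wealth `x₀`. -/
def wealth (M : FactorMarket μ T N Ns Nξ) (x₀ : ℝ) (π : ℕ → Ω → (Fin N → ℝ)) : ℕ → Ω → ℝ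
  | 0 => fun _ => x₀
  | t + 1 => fun ω => M.r0 (t + 1) * M.wealth x₀ π t ω + M.r (t + 1) ω ⬝ᵥ π t ω

/-- Admissible portfolio processes: `π_t` is known at time `t` and lies in the cone `A t`, and the
terminal wealth is square integrable, so that its mean and variance exist. -/
def Admissible (M : FactorMarket μ T N Ns Nξ) (A : ℕ → Set (Fin N → ℝ)) (x₀ : ℝ)
    (π : ℕ → Ω → (Fin N → ℝ)) : Prop :=
  (∀ t < T, Measurable[M.ℱ t] (π t) ∧ ∀ᵐ ω ∂μ, π t ω ∈ A t) ∧ MemLp (M.wealth x₀ π T) 2 μ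

/-- `E[x_T]`. -/
def mean (M : FactorMarket μ T N Ns Nξ) (x₀ : ℝ) (π : ℕ → Ω → (Fin N → ℝ)) : ℝ :=
  ∫ ω, M.wealth x₀ π T ω ∂μ

/-- `Var[x_T]`. -/
def var (M : FactorMarket μ T N Ns Nξ) (x₀ : ℝ) (π : ℕ → Ω → (Fin N → ℝ)) : ℝ :=
  variance (M.wealth x₀ π T) μ

/-- `π` solves the mean-variance problem: minimise `Var[x_T] - 2 λ E[x_T]` over all admissible
portfolio processes. -/
def IsOptimal (M : FactorMarket μ T N Ns Nξ) (A : ℕ → Set (Fin N → ℝ)) (x₀ lam : ℝ)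
    (π : ℕ → Ω → (Fin N → ℝ)) : Prop :=
  M.Admissible A x₀ π ∧ ∀ π', M.Admissible A x₀ π' →
    M.var x₀ π - 2 * lam * M.mean x₀ π ≤ M.var x₀ π' - 2 * lam * M.mean x₀ π'

/-- The pairs `(E[x_T], Var[x_T])` of admissible portfolio processes. -/
def attainable (M : FactorMarket μ T N Ns Nξ) (A : ℕ → Set (Fin N → ℝ)) (x₀ : ℝ) :
    Set (ℝ × ℝ) :=
  {p | ∃ π, M.Admissible A x₀ π ∧ p = (M.mean x₀ π, M.var x₀ π)}

/-- The attainable pairs that no other attainable pair dominates. -/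
def efficientFrontier (M : FactorMarket μ T N Ns Nξ) (A : ℕ → Set (Fin N → ℝ)) (x₀ : ℝ) :
    Set (ℝ × ℝ) :=
  {p | p ∈ M.attainable A x₀ ∧
    ∀ q ∈ M.attainable A x₀, p.1 ≤ q.1 → q.2 ≤ p.2 → q = p}

/-- Wealth process under the feedback policy `φ`, which invests `φ t x σ` at time `t` when the
wealth is `x` and the state is `σ`. -/
def feedbackWealth (M : FactorMarket μ T N Ns Nξ) (x₀ : ℝ)
    (φ : ℕ → ℝ → (Fin Ns → ℝ) → (Fin N → ℝ)) : ℕ → Ω → ℝ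
  | 0 => fun _ => x₀
  | t + 1 => fun ω => M.r0 (t + 1) * M.feedbackWealth x₀ φ t ω
      + M.r (t + 1) ω ⬝ᵥ φ t (M.feedbackWealth x₀ φ t ω) (M.s t ω)

/-- Portfolio process generated by the feedback policy `φ`. -/
def feedbackPortfolio (M : FactorMarket μ T N Ns Nξ) (x₀ : ℝ)
    (φ : ℕ → ℝ → (Fin Ns → ℝ) → (Fin N → ℝ)) (t : ℕ) (ω : Ω) : Fin N → ℝ :=
  φ t (M.feedbackWealth x₀ φ t ω) (M.s t ω)

theorem wealth_feedbackPortfolio (M : FactorMarket μ T N Ns Nξ) (x₀ : ℝ)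
    (φ : ℕ → ℝ → (Fin Ns → ℝ) → (Fin N → ℝ)) (t : ℕ) :
    M.wealth x₀ (M.feedbackPortfolio x₀ φ) t = M.feedbackWealth x₀ φ t := by
  induction t with
  | zero => rfl
  | succ t ih => funext ω; simp only [wealth, feedbackWealth, feedbackPortfolio, ih]

/-- The piecewise linear feedback policy built from `km`, `kp` and `d = d_0⁻(s_0)`. -/
def optPolicy (M : FactorMarket μ T N Ns Nξ) (x₀ lam d : ℝ)
    (km kp : ℕ → (Fin Ns → ℝ) → (Fin N → ℝ)) (t : ℕ) (x : ℝ) (σ : Fin Ns → ℝ) : Fin N → ℝ :=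
  if M.rho t * x ≤ M.rho 0 * x₀ + lam / d then
    -((M.r0 (t + 1) * x - (M.rho 0 * x₀ * d + lam) / (M.rho (t + 1) * d)) • km t σ)
  else
    (M.r0 (t + 1) * x - (M.rho 0 * x₀ * d + lam) / (M.rho (t + 1) * d)) • kp t σ

end FactorMarket

end MeanVariance

end

open MeasureTheory ProbabilityTheory
open scoped Matrix

noncomputable section

namespace MeanVariance

/-! The variance term blocks direct dynamic programming, so the argument goes through a quadratic
target problem. Fix a target `γ = ρ₀x₀ + a` with `a ≥ 0` and follow the gap `y = ρ_t x_t - γ`.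
Because every `A t` is a cone, a position can be measured in units of `|y|`, and the value of the
problem at time `t` is homogeneous: `y² d_t⁻` below the target and `y² d_t⁺` above it (`value`). A
gap that changes sign within a period switches weights, which is exactly the case split in the
recursion for `d_t^±`. No convexity is involved.

By the Markov property, the expected value function cannot decrease along an admissible process
(`expectedValue_le_succ`), and it stays constant along the feedback policy aimed at `a = λ/d`
(`expectedValue_succ_optPolicy`). At time `T` it equals `Var + (E - γ)²`. With `m` the mean in
excess of `ρ₀x₀` and `v` the variance, this gives `d a² ≤ v + (m - a)²` for all `a ≥ 0`
(`dMinus_mul_sq_le`), with equality for the feedback policy at `a = λ/d`.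

Choosing the best `a` yields `d m² ≤ (1 - d) v` whenever `m ≥ 0`. This single inequality carries
both optimality and the shape of the frontier. The moments of the policy follow from the equality
together with a first-order condition: scaling a portfolio by `α ≥ 0` keeps it admissible and acts
linearly on the discounted gain, so `α = 1` minimises `α² v + (α m - a)²` and hence `v + m(m - a) =
0`.

The analytic input is the positive definite covariance. It makes the one-period loss positive and
coercive, so minimisers exist over closed sets and `d_t^±` stay positive almost surely. A measurable
selection theorem makes the minimisers measurable in the state. -/

theorem csInf_image_eq_of_subset_closure {X : Type*} [TopologicalSpace X] {f : X → ℝ}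
    (hf : Continuous f) {C D : Set X} (hbd : BddBelow (f '' C)) (hDC : D ⊆ C)
    (hCD : C ⊆ closure D) :
    sInf (f '' C) = sInf (f '' D) := by
  rcases D.eq_empty_or_nonempty with rfl | hD
  · rw [closure_empty, Set.subset_empty_iff] at hCD
    rw [hCD]
  have hbd' := hbd.mono (Set.image_mono (f := f) hDC)
  refine le_antisymm (csInf_le_csInf hbd (hD.image _) (Set.image_mono hDC)) ?_
  refine le_csInf ((hD.mono hDC).image _) ?_
  rintro _ ⟨k, hk, rfl⟩
  exact closure_minimal (s := D) (t := {k | sInf (f '' D) ≤ f k})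
    (fun k hk => csInf_le hbd' ⟨k, hk, rfl⟩) (isClosed_le continuous_const hf) (hCD hk)

/-! ### The one-period loss: continuity, positivity, coercivity. -/

section OnePeriod

variable {N Ns : ℕ}

/-- The integrand of `lossMinus`. -/
def lossIntegrand (dm dp : (Fin Ns → ℝ) → ℝ) (k : Fin N → ℝ)
    (p : (Fin N → ℝ) × (Fin Ns → ℝ)) : ℝ :=
  (1 - p.1 ⬝ᵥ k) ^ 2 * (if p.1 ⬝ᵥ k ≤ 1 then dm p.2 else dp p.2)

/-- This symmetry halves the work: every fact about `lossPlus` over `C` is read off from `lossMinus`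
with exchanged weights over `-C`. -/
theorem lossPlus_eq_lossMinus_neg (ν : Measure ((Fin N → ℝ) × (Fin Ns → ℝ)))
    (dm dp : (Fin Ns → ℝ) → ℝ) (k : Fin N → ℝ) :
    lossPlus ν dm dp k = lossMinus ν dp dm (-k) := by
  unfold lossPlus lossMinus
  congr 1
  funext p
  simp only [dotProduct_neg, sub_neg_eq_add, neg_le]

/-- The law `ν` of the next return and state, together with the next weights `dm`, `dp`, satisfies
the conditions under which the one-period problem is well posed. -/
structure RegularStep (ν : Measure ((Fin N → ℝ) × (Fin Ns → ℝ)))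
    (dm dp : (Fin Ns → ℝ) → ℝ) : Prop where
  memLp : ∀ i, MemLp (fun p : (Fin N → ℝ) × (Fin Ns → ℝ) => p.1 i) 2 ν
  posDef : (Matrix.of fun i j => covariance (fun p : (Fin N → ℝ) × (Fin Ns → ℝ) => p.1 i)
    (fun p => p.1 j) ν).PosDef
  minus_nonneg : ∀ σ, 0 ≤ dm σ
  minus_le_one : ∀ σ, dm σ ≤ 1
  plus_nonneg : ∀ σ, 0 ≤ dp σ
  plus_le_one : ∀ σ, dp σ ≤ 1
  minus_meas : AEMeasurable (fun p : (Fin N → ℝ) × (Fin Ns → ℝ) => dm p.2) ν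
  plus_meas : AEMeasurable (fun p : (Fin N → ℝ) × (Fin Ns → ℝ) => dp p.2) ν
  minus_pos : ∀ᵐ p ∂ν, 0 < dm p.2
  plus_pos : ∀ᵐ p ∂ν, 0 < dp p.2

theorem lossIntegrand_nonneg {dm dp : (Fin Ns → ℝ) → ℝ} (hm : ∀ σ, 0 ≤ dm σ)
    (hp : ∀ σ, 0 ≤ dp σ) (k : Fin N → ℝ) (p : (Fin N → ℝ) × (Fin Ns → ℝ)) :
    0 ≤ lossIntegrand dm dp k p := by
  unfold lossIntegrand
  have := hm p.2
  have := hp p.2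
  split_ifs <;> positivity

theorem lossMinus_nonneg (ν : Measure ((Fin N → ℝ) × (Fin Ns → ℝ)))
    {dm dp : (Fin Ns → ℝ) → ℝ} (hm : ∀ σ, 0 ≤ dm σ)
    (hp : ∀ σ, 0 ≤ dp σ) (k : Fin N → ℝ) : 0 ≤ lossMinus ν dm dp k :=
  integral_nonneg (lossIntegrand_nonneg hm hp k)

theorem lossMinus_zero_le_one (ν : Measure ((Fin N → ℝ) × (Fin Ns → ℝ))) [IsProbabilityMeasure ν]
    {dm dp : (Fin Ns → ℝ) → ℝ} (hm : ∀ σ, 0 ≤ dm σ) (hm1 : ∀ σ, dm σ ≤ 1) :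
    lossMinus ν dm dp 0 ≤ 1 := by
  have h : lossMinus ν dm dp 0 = ∫ p, dm p.2 ∂ν := by simp [lossMinus]
  rw [h]
  calc ∫ p, dm p.2 ∂ν ≤ ∫ _, (1 : ℝ) ∂ν :=
        integral_mono_of_nonneg (ae_of_all _ fun p => hm p.2) (integrable_const _)
          (ae_of_all _ fun p => hm1 p.2)
    _ = 1 := by simp

/-- The weight jumps where `r ⬝ᵥ k = 1`, but the squared factor vanishes there. -/
theorem continuous_lossIntegrand (dm dp : (Fin Ns → ℝ) → ℝ)
    (p : (Fin N → ℝ) × (Fin Ns → ℝ)) :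
    Continuous fun k => lossIntegrand dm dp k p := by
  have h : (fun k => lossIntegrand dm dp k p) = fun k =>
      if p.1 ⬝ᵥ k ≤ 1 then (1 - p.1 ⬝ᵥ k) ^ 2 * dm p.2 else (1 - p.1 ⬝ᵥ k) ^ 2 * dp p.2 := by
    funext k
    simp only [lossIntegrand, mul_ite]
  have hc : Continuous fun k : Fin N → ℝ => p.1 ⬝ᵥ k := by
    unfold dotProduct; fun_prop
  rw [h]
  refine Continuous.if_le (by fun_prop) (by fun_prop) hc continuous_const ?_
  intro k hk
  rw [hk]; simp

/-- The weights are exchanged when the sign of the position is. -/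
theorem RegularStep.swap {ν : Measure ((Fin N → ℝ) × (Fin Ns → ℝ))}
    {dm dp : (Fin Ns → ℝ) → ℝ} (h : RegularStep ν dm dp) : RegularStep ν dp dm :=
  ⟨h.memLp, h.posDef, h.plus_nonneg, h.plus_le_one, h.minus_nonneg, h.minus_le_one,
    h.plus_meas, h.minus_meas, h.plus_pos, h.minus_pos⟩

namespace RegularStep

variable {ν : Measure ((Fin N → ℝ) × (Fin Ns → ℝ))} {dm dp : (Fin Ns → ℝ) → ℝ}

theorem memLp_dotProduct (h : RegularStep ν dm dp) (k : Fin N → ℝ) :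
    MemLp (fun p : (Fin N → ℝ) × (Fin Ns → ℝ) => p.1 ⬝ᵥ k) 2 ν := by
  unfold dotProduct
  exact memLp_finsetSum _ fun i _ => (h.memLp i).mul_const _

theorem abs_dotProduct_le (r k : Fin N → ℝ) : |r ⬝ᵥ k| ≤ ‖k‖ * ∑ i, |r i| := by
  unfold dotProduct
  rw [Finset.mul_sum]
  refine (Finset.abs_sum_le_sum_abs _ _).trans (Finset.sum_le_sum fun i _ => ?_)
  rw [abs_mul, mul_comm]
  exact mul_le_mul_of_nonneg_right (norm_le_pi_norm k i) (abs_nonneg _)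

/-- A portfolio with almost surely constant excess return is zero. -/
theorem eq_zero_of_dotProduct_ae_eq_const [IsProbabilityMeasure ν] (h : RegularStep ν dm dp)
    {k : Fin N → ℝ} {c : ℝ} (hk : ∀ᵐ p ∂ν, p.1 ⬝ᵥ k = c) : k = 0 := by
  by_contra hne
  have hpos := h.posDef.dotProduct_mulVec_pos hne
  refine hpos.ne' ?_
  -- Entry `i` of the covariance matrix applied to `k` is the covariance of `r i` with the constant
  -- `r ⬝ᵥ k`.
  have hz : (Matrix.of fun i j => covariance (fun p : (Fin N → ℝ) × (Fin Ns → ℝ) => p.1 i)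
      (fun p => p.1 j) ν) *ᵥ k = 0 := by
    funext i
    have h1 : covariance (fun p : (Fin N → ℝ) × (Fin Ns → ℝ) => p.1 i)
        (fun p => ∑ j, p.1 j * k j) ν = 0 := by
      have : covariance (fun p : (Fin N → ℝ) × (Fin Ns → ℝ) => p.1 i)
        (fun p => ∑ j, p.1 j * k j) ν = covariance (fun p : (Fin N → ℝ) × (Fin Ns → ℝ) => p.1 i)
        (fun _ => c) ν := by
        unfold covariance
        have hk' : (fun p : (Fin N → ℝ) × (Fin Ns → ℝ) => ∑ j, p.1 j * k j) =ᵐ[ν] fun _ => c := hk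
        rw [integral_congr_ae hk']
        refine integral_congr_ae ?_
        filter_upwards [hk'] with p hp
        rw [hp]
      rw [this, covariance_const_right]
    rw [covariance_fun_sum_right (fun j => (h.memLp j).mul_const _) (h.memLp i)] at h1
    simp only [covariance_mul_const_right] at h1
    simpa [Matrix.mulVec, dotProduct] using h1
  rw [hz]; simp

theorem integrable_bound [IsProbabilityMeasure ν] (h : RegularStep ν dm dp) (R : ℝ) :
    Integrable (fun p : (Fin N → ℝ) × (Fin Ns → ℝ) => (1 + R * ∑ i, |p.1 i|) ^ 2) ν := by
  have h1 : MemLp (fun p : (Fin N → ℝ) × (Fin Ns → ℝ) => ∑ i, |p.1 i|) 2 ν :=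
    memLp_finsetSum _ fun i _ => (h.memLp i).abs
  exact ((memLp_const (1 : ℝ)).add (h1.const_mul R)).integrable_sq

/-- Parametric integrals dominated by a quadratic function of the return are continuous. -/
theorem continuous_integral [IsProbabilityMeasure ν] (h : RegularStep ν dm dp)
    {F : (Fin N → ℝ) → (Fin N → ℝ) × (Fin Ns → ℝ) → ℝ}
    (hF : ∀ k, AEStronglyMeasurable (F k) ν)
    (hb : ∀ k, ∀ p, |F k p| ≤ (1 + |p.1 ⬝ᵥ k|) ^ 2)
    (hc : ∀ p, Continuous fun k => F k p) : Continuous fun k => ∫ p, F k p ∂ν := by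
  rw [continuous_iff_continuousAt]
  intro k₀
  -- The radius `‖k₀‖ + 1` serves all `k` near `k₀` at once.
  refine continuousAt_of_dominated (bound := fun p => (1 + (‖k₀‖ + 1) * ∑ i, |p.1 i|) ^ 2)
    (Filter.Eventually.of_forall hF) ?_ (h.integrable_bound _)
    (ae_of_all _ fun p => (hc p).continuousAt)
  have hU : ∀ᶠ k in nhds k₀, ‖k‖ < ‖k₀‖ + 1 :=
    (continuous_norm.tendsto k₀).eventually (gt_mem_nhds (by linarith))
  filter_upwards [hU] with k hk
  refine ae_of_all _ fun p => ?_
  rw [Real.norm_eq_abs]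
  refine (hb k p).trans ?_
  have hs : 0 ≤ ∑ i, |p.1 i| := Finset.sum_nonneg fun i _ => abs_nonneg _
  have : |p.1 ⬝ᵥ k| ≤ (‖k₀‖ + 1) * ∑ i, |p.1 i| :=
    (abs_dotProduct_le _ _).trans (mul_le_mul_of_nonneg_right hk.le hs)
  gcongr

theorem aestronglyMeasurable_lossIntegrand (h : RegularStep ν dm dp) (k : Fin N → ℝ) :
    AEStronglyMeasurable (lossIntegrand dm dp k) ν := by
  have hd : Measurable fun p : (Fin N → ℝ) × (Fin Ns → ℝ) => p.1 ⬝ᵥ k := by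
    unfold dotProduct; fun_prop
  have hs : MeasurableSet {p : (Fin N → ℝ) × (Fin Ns → ℝ) | p.1 ⬝ᵥ k ≤ 1} :=
    measurableSet_le hd measurable_const
  have h1 : AEMeasurable (fun p : (Fin N → ℝ) × (Fin Ns → ℝ) => (1 - p.1 ⬝ᵥ k) ^ 2) ν := by
    fun_prop
  refine (h1.mul ?_).aestronglyMeasurable
  classical
  refine ((h.minus_meas.indicator hs).add (h.plus_meas.indicator hs.compl)).congr
    (ae_of_all _ fun p => ?_)
  by_cases hp : p.1 ⬝ᵥ k ≤ 1
  · simp [Set.indicator, hp]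
  · simp [Set.indicator, hp]

theorem abs_lossIntegrand_le (h : RegularStep ν dm dp) (k : Fin N → ℝ)
    (p : (Fin N → ℝ) × (Fin Ns → ℝ)) : |lossIntegrand dm dp k p| ≤ (1 + |p.1 ⬝ᵥ k|) ^ 2 := by
  rw [abs_of_nonneg (lossIntegrand_nonneg h.minus_nonneg h.plus_nonneg k p)]
  have h1 : (1 - p.1 ⬝ᵥ k) ^ 2 ≤ (1 + |p.1 ⬝ᵥ k|) ^ 2 := by
    rw [sq_le_sq, abs_of_nonneg (a := 1 + |p.1 ⬝ᵥ k|) (by positivity)]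
    exact (abs_sub _ _).trans (by simp)
  unfold lossIntegrand
  refine (mul_le_of_le_one_right (sq_nonneg _) ?_).trans h1
  split_ifs
  · exact h.minus_le_one _
  · exact h.plus_le_one _

theorem integrable_lossIntegrand [IsProbabilityMeasure ν] (h : RegularStep ν dm dp)
    (k : Fin N → ℝ) :
    Integrable (lossIntegrand dm dp k) ν := by
  refine (h.integrable_bound ‖k‖).mono' (h.aestronglyMeasurable_lossIntegrand k)
    (ae_of_all _ fun p => ?_)
  rw [Real.norm_eq_abs]
  refine (h.abs_lossIntegrand_le k p).trans ?_
  have := abs_dotProduct_le p.1 k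
  gcongr

theorem continuous_lossMinus [IsProbabilityMeasure ν] (h : RegularStep ν dm dp) :
    Continuous (lossMinus ν dm dp) :=
  h.continuous_integral h.aestronglyMeasurable_lossIntegrand h.abs_lossIntegrand_le
    (continuous_lossIntegrand dm dp)

/-- Zero loss with positive weights forces `r ⬝ᵥ k = 1` almost surely. Nondegeneracy then gives `k =
0`, and `0 = 1` is absurd. -/
theorem lossMinus_pos [IsProbabilityMeasure ν] (h : RegularStep ν dm dp) (k : Fin N → ℝ) :
    0 < lossMinus ν dm dp k := by
  refine lt_of_le_of_ne (lossMinus_nonneg ν h.minus_nonneg h.plus_nonneg k) fun h0 => ?_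
  have hz := (integral_eq_zero_iff_of_nonneg
    (lossIntegrand_nonneg h.minus_nonneg h.plus_nonneg k) (h.integrable_lossIntegrand k)).1 h0.symm
  have hk : ∀ᵐ p ∂ν, p.1 ⬝ᵥ k = 1 := by
    filter_upwards [hz, h.minus_pos, h.plus_pos] with p hp hm hp'
    unfold lossIntegrand at hp
    rcases mul_eq_zero.1 hp with h1 | h1
    · linarith [pow_eq_zero_iff (two_ne_zero) |>.1 h1]
    · split_ifs at h1 <;> simp_all
  have := h.eq_zero_of_dotProduct_ae_eq_const hk
  subst this
  obtain ⟨p, hp⟩ := hk.exists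
  simp at hp

/-- The one-period loss grows quadratically. -/
theorem exists_coercive [IsProbabilityMeasure ν] (h : RegularStep ν dm dp) :
    ∃ c > 0, ∀ k, c * ‖k‖ ^ 2 - 1 ≤ lossMinus ν dm dp k := by
  -- A weight independent of `k` makes `∫ F k` homogeneous of degree two, so that its minimum over
  -- the unit sphere controls it everywhere.
  let w : (Fin N → ℝ) × (Fin Ns → ℝ) → ℝ := fun p => min (dm p.2) (dp p.2)
  have hw0 : ∀ p, 0 ≤ w p := fun p => le_min (h.minus_nonneg _) (h.plus_nonneg _)
  have hw1 : ∀ p, w p ≤ 1 := fun p => min_le_of_left_le (h.minus_le_one _)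
  have hwm : AEMeasurable w ν := h.minus_meas.min h.plus_meas
  let F : (Fin N → ℝ) → (Fin N → ℝ) × (Fin Ns → ℝ) → ℝ := fun k p => (p.1 ⬝ᵥ k) ^ 2 * w p
  have hF0 : ∀ k p, 0 ≤ F k p := fun k p => mul_nonneg (sq_nonneg _) (hw0 p)
  have hFm : ∀ k, AEStronglyMeasurable (F k) ν := fun k =>
    ((h.memLp_dotProduct k).aestronglyMeasurable.pow 2).mul hwm.aestronglyMeasurable
  have hFb : ∀ k p, F k p ≤ (p.1 ⬝ᵥ k) ^ 2 := fun k p =>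
    mul_le_of_le_one_right (sq_nonneg _) (hw1 p)
  have hFi : ∀ k, Integrable (F k) ν := fun k =>
    (h.memLp_dotProduct k).integrable_sq.mono' (hFm k) (ae_of_all _ fun p => by
      rw [Real.norm_eq_abs, abs_of_nonneg (hF0 k p)]; exact hFb k p)
  have hcont : Continuous fun k => ∫ p, F k p ∂ν := by
    refine h.continuous_integral hFm (fun k p => ?_) (fun p => ?_)
    · rw [abs_of_nonneg (hF0 k p)]
      refine (hFb k p).trans ?_
      rw [← sq_abs]
      gcongr; linarith
    · have hc : Continuous fun k : Fin N → ℝ => p.1 ⬝ᵥ k := by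
        unfold dotProduct; fun_prop
      exact (hc.pow 2).mul continuous_const
  have hpos : ∀ k, k ≠ 0 → 0 < ∫ p, F k p ∂ν := by
    intro k hk
    refine lt_of_le_of_ne (integral_nonneg (hF0 k)) fun h0 => hk ?_
    have hz := (integral_eq_zero_iff_of_nonneg (hF0 k) (hFi k)).1 h0.symm
    refine h.eq_zero_of_dotProduct_ae_eq_const (c := 0) ?_
    filter_upwards [hz, h.minus_pos, h.plus_pos] with p hp hm hp'
    rcases mul_eq_zero.1 hp with h1 | h1
    · exact pow_eq_zero_iff two_ne_zero |>.1 h1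
    · exact absurd h1 (lt_min hm hp').ne'
  obtain ⟨c, hc, hq⟩ : ∃ c > 0, ∀ k, c * ‖k‖ ^ 2 ≤ ∫ p, F k p ∂ν := by
    -- The sphere is empty when there are no risky assets.
    rcases (Metric.sphere (0 : Fin N → ℝ) 1).eq_empty_or_nonempty with he | hne
    · refine ⟨1, one_pos, fun k => ?_⟩
      have hk : k = 0 := by
        by_contra hk
        have : ‖k‖⁻¹ • k ∈ Metric.sphere (0 : Fin N → ℝ) 1 := by
          simp [norm_smul, hk]
        rw [he] at this
        exact this
      subst hk
      simpa using integral_nonneg (hF0 0)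
    · obtain ⟨u, hu, hmin⟩ := (isCompact_sphere (0 : Fin N → ℝ) 1).exists_isMinOn hne
        hcont.continuousOn
      have hu0 : u ≠ 0 := by rintro rfl; simp at hu
      refine ⟨∫ p, F u p ∂ν, hpos u hu0, fun k => ?_⟩
      by_cases hk : k = 0
      · subst hk; simpa using integral_nonneg (hF0 0)
      have hk' : 0 < ‖k‖ := norm_pos_iff.2 hk
      have hs : ‖k‖⁻¹ • k ∈ Metric.sphere (0 : Fin N → ℝ) 1 := by
        simp [norm_smul, hk]
      have h1 : ∫ p, F u p ∂ν ≤ ∫ p, F (‖k‖⁻¹ • k) p ∂ν := hmin hs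
      have h2 : ∫ p, F k p ∂ν = ‖k‖ ^ 2 * ∫ p, F (‖k‖⁻¹ • k) p ∂ν := by
        rw [← integral_const_mul]
        congr 1; funext p
        simp only [F, dotProduct_smul, smul_eq_mul]
        field_simp
      rw [h2, mul_comm]
      gcongr
  refine ⟨c / 2, by positivity, fun k => ?_⟩
  have h1 : ∫ p, (F k p / 2 - 1) ∂ν ≤ lossMinus ν dm dp k := by
    refine integral_mono (((hFi k).div_const 2).sub (integrable_const 1))
      (h.integrable_lossIntegrand k) fun p => ?_
    have hws : w p ≤ (if p.1 ⬝ᵥ k ≤ 1 then dm p.2 else dp p.2) := by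
      split_ifs
      · exact min_le_left _ _
      · exact min_le_right _ _
    have h3 : (1 - p.1 ⬝ᵥ k) ^ 2 * w p ≤ lossIntegrand dm dp k p :=
      mul_le_mul_of_nonneg_left hws (sq_nonneg _)
    -- `(1 - x)² - x²/2 + 1 = (x - 2)²/2`.
    have h4 : ((p.1 ⬝ᵥ k) ^ 2 / 2 - 1) * w p ≤ (1 - p.1 ⬝ᵥ k) ^ 2 * w p :=
      mul_le_mul_of_nonneg_right (by nlinarith [sq_nonneg (p.1 ⬝ᵥ k - 2)]) (hw0 p)
    have := hw1 p
    change F k p / 2 - 1 ≤ lossIntegrand dm dp k p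
    simp only [F]
    linarith
  rw [integral_sub ((hFi k).div_const 2) (integrable_const 1), integral_div] at h1
  simp only [integral_const, probReal_univ, smul_eq_mul, mul_one] at h1
  linarith [hq k]

theorem exists_isMinOn [IsProbabilityMeasure ν] (h : RegularStep ν dm dp)
    {C : Set (Fin N → ℝ)} (hC : IsClosed C) (hne : C.Nonempty) :
    ∃ k ∈ C, IsMinOn (lossMinus ν dm dp) C k := by
  obtain ⟨c, hc, hb⟩ := h.exists_coercive
  obtain ⟨k₀, hk₀⟩ := hne
  refine h.continuous_lossMinus.continuousOn.exists_isMinOn' hC hk₀ ?_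
  have ht : Filter.Tendsto (fun k : Fin N → ℝ => c * ‖k‖ ^ 2 - 1) (Filter.cocompact _)
      Filter.atTop :=
    Filter.tendsto_atTop_add_const_right _ _
      (((Filter.tendsto_pow_atTop two_ne_zero).comp
        (tendsto_norm_cocompact_atTop (E := Fin N → ℝ))).const_mul_atTop hc)
  have := (Filter.tendsto_atTop_mono hb ht).eventually_ge_atTop (lossMinus ν dm dp k₀)
  exact Filter.Eventually.filter_mono inf_le_left this

theorem bddBelow_lossMinus (h : RegularStep ν dm dp) (C : Set (Fin N → ℝ)) :
    BddBelow (lossMinus ν dm dp '' C) :=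
  ⟨0, by rintro _ ⟨k, _, rfl⟩; exact lossMinus_nonneg ν h.minus_nonneg h.plus_nonneg k⟩

/-- The cone need not be closed here. By continuity the infimum is unchanged on the closure, where
it is attained at a point of positive loss. -/
theorem sInf_lossMinus_pos [IsProbabilityMeasure ν] (h : RegularStep ν dm dp)
    {C : Set (Fin N → ℝ)} (hne : C.Nonempty) :
    0 < sInf (lossMinus ν dm dp '' C) := by
  rw [← csInf_image_eq_of_subset_closure h.continuous_lossMinus
    (h.bddBelow_lossMinus (closure C)) subset_closure subset_rfl]
  obtain ⟨k, hk, hmin⟩ := h.exists_isMinOn isClosed_closure hne.closure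
  refine (h.lossMinus_pos k).trans_le (le_csInf (hne.closure.image _) ?_)
  rintro _ ⟨k', hk', rfl⟩
  exact hmin hk'

end RegularStep

end OnePeriod

/-! ### Measurable selection of minimisers. -/

section Selection

variable {X α : Type*}

/-- Intersection of the closed balls of radius `2⁻ʲ` about the points of `u` listed in `l`, the
last entry of the list having `j = 0`. -/
def ballInter [PseudoMetricSpace X] (u : ℕ → X) : List ℕ → Set X
  | [] => Set.univ
  | i :: l => Metric.closedBall (u i) ((1 / 2) ^ l.length) ∩ ballInter u l

theorem isClosed_ballInter [PseudoMetricSpace X] (u : ℕ → X) (l : List ℕ) :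
    IsClosed (ballInter u l) := by
  induction l with
  | nil => exact isClosed_univ
  | cons i l ih => exact Metric.isClosed_closedBall.inter ih

/-- Greedy choice of balls whose intersection meets `F a`. -/
def greedyList [PseudoMetricSpace X] (u : ℕ → X) (F : α → Set X) : ℕ → α → List ℕ
  | 0, _ => []
  | n + 1, a =>
    sInf {i | (F a ∩ ballInter u (i :: greedyList u F n a)).Nonempty} :: greedyList u F n a

theorem length_greedyList [PseudoMetricSpace X] (u : ℕ → X) (F : α → Set X) (n : ℕ) (a : α) :
    (greedyList u F n a).length = n := by
  induction n with
  | zero => rfl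
  | succ n ih => simp [greedyList, ih]

theorem exists_ballInter_cons [PseudoMetricSpace X] {u : ℕ → X} (hu : DenseRange u) {S : Set X}
    {l : List ℕ} (h : (S ∩ ballInter u l).Nonempty) :
    ∃ i, (S ∩ ballInter u (i :: l)).Nonempty := by
  obtain ⟨x, hxS, hxl⟩ := h
  obtain ⟨i, hi⟩ := hu.exists_dist_lt x (ε := (1 / 2) ^ l.length) (by positivity)
  exact ⟨i, x, hxS, hi.le, hxl⟩

theorem greedyList_nonempty [PseudoMetricSpace X] {u : ℕ → X} (hu : DenseRange u)
    {F : α → Set X} (hne : ∀ a, (F a).Nonempty) (n : ℕ) (a : α) :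
    (F a ∩ ballInter u (greedyList u F n a)).Nonempty := by
  induction n with
  | zero => simpa [greedyList, ballInter] using hne a
  | succ n ih => exact Nat.sInf_mem (exists_ballInter_cons hu ih)

theorem measurableSet_sInf_eq [MeasurableSpace α] {P : ℕ → Set α}
    (hP : ∀ i, MeasurableSet (P i)) (i : ℕ) :
    MeasurableSet {a | sInf {j | a ∈ P j} = i} := by
  -- The second piece accounts for `sInf ∅ = 0` in `ℕ`.
  have h : {a | sInf {j | a ∈ P j} = i} =
      ((P i ∩ ⋂ j ∈ Set.Iio i, (P j)ᶜ) ∪ {a | i = 0 ∧ a ∈ ⋂ j, (P j)ᶜ}) := by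
    ext a
    simp only [Set.mem_ofPred_eq, Set.mem_union, Set.mem_inter_iff, Set.mem_iInter,
      Set.mem_compl_iff, Set.mem_Iio]
    constructor
    · intro ha
      by_cases hex : ∃ j, a ∈ P j
      · left
        have hmem := Nat.sInf_mem (s := {j | a ∈ P j}) hex
        rw [ha] at hmem
        exact ⟨hmem, fun j hj hj' => by
          have := Nat.sInf_le (s := {j | a ∈ P j}) hj'
          omega⟩
      · right
        push Not at hex
        refine ⟨?_, hex⟩
        rw [← ha]
        simp [hex]
    · rintro (⟨h1, h2⟩ | ⟨rfl, h2⟩)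
      · refine le_antisymm (Nat.sInf_le h1) (le_csInf ⟨i, h1⟩ fun j hj => ?_)
        by_contra hlt
        exact h2 j (not_le.1 hlt) hj
      · simp [h2]
  rw [h]
  refine ((hP i).inter
    (MeasurableSet.biInter (Set.to_countable _) fun j _ => (hP j).compl)).union ?_
  exact (MeasurableSet.const _).inter (MeasurableSet.iInter fun j => (hP j).compl)

/-- Once the earlier choices are frozen to `l`, the next index is a first hitting index for a fixed
sequence of measurable events. -/
theorem measurableSet_greedyList_eq [MeasurableSpace α] [PseudoMetricSpace X] (u : ℕ → X)
    {F : α → Set X} (hm : ∀ C, IsClosed C → MeasurableSet {a | (F a ∩ C).Nonempty})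
    (n : ℕ) (l : List ℕ) :
    MeasurableSet {a | greedyList u F n a = l} := by
  induction n generalizing l with
  | zero =>
    simp only [greedyList]
    exact MeasurableSet.const _
  | succ n ih =>
    cases l with
    | nil => simp [greedyList]
    | cons i l =>
      have h : {a | greedyList u F (n + 1) a = i :: l} =
          {a | greedyList u F n a = l} ∩
            {a | sInf {j | a ∈ {a | (F a ∩ ballInter u (j :: l)).Nonempty}} = i} := by
        ext a
        simp only [greedyList, List.cons.injEq, Set.mem_ofPred_eq, Set.mem_inter_iff]
        constructor
        · rintro ⟨h1, h2⟩
          rw [h2] at h1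
          exact ⟨h2, h1⟩
        · rintro ⟨h1, h2⟩
          rw [h1]
          exact ⟨h2, rfl⟩
      rw [h]
      exact (ih l).inter (measurableSet_sInf_eq (fun j => hm _ (isClosed_ballInter u _)) i)

/-- A set-valued map with closed nonempty values, whose preimages of closed sets are measurable,
has a measurable selector. -/
theorem exists_measurable_selector [MeasurableSpace α] [MetricSpace X] [CompleteSpace X]
    [TopologicalSpace.SeparableSpace X] [MeasurableSpace X] [BorelSpace X] {F : α → Set X}
    (hne : ∀ a, (F a).Nonempty) (hcl : ∀ a, IsClosed (F a))
    (hm : ∀ C, IsClosed C → MeasurableSet {a | (F a ∩ C).Nonempty}) :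
    ∃ f : α → X, Measurable f ∧ ∀ a, f a ∈ F a := by
  rcases isEmpty_or_nonempty α with hα | ⟨⟨a₀⟩⟩
  · exact ⟨fun a => hα.elim a, measurable_of_empty _, fun a => hα.elim a⟩
  have : Nonempty X := ⟨(hne a₀).some⟩
  let u := TopologicalSpace.denseSeq X
  have hu : DenseRange u := TopologicalSpace.denseRange_denseSeq X
  let g : ℕ → α → X := fun n a => u ((greedyList u F (n + 1) a).headD 0)
  have hg : ∀ n, Measurable (g n) := by
    intro n S _
    -- There are only countably many lists, so `S` may be arbitrary.
    have h : g n ⁻¹' S = ⋃ l ∈ {l : List ℕ | u (l.headD 0) ∈ S},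
        {a | greedyList u F (n + 1) a = l} := by
      ext a; simp [g]
    rw [h]
    exact MeasurableSet.biUnion (Set.to_countable _) fun l _ =>
      measurableSet_greedyList_eq u hm _ l
  have hball : ∀ a n m, m ≤ n →
      ballInter u (greedyList u F (n + 1) a) ⊆ Metric.closedBall (g m a) ((1 / 2) ^ m) := by
    intro a n
    induction n with
    | zero =>
      intro m hmn x hx
      obtain rfl : m = 0 := by omega
      exact hx.1
    | succ n ih =>
      intro m hmn x hx
      rcases hmn.eq_or_lt with rfl | hlt
      · have h1 := hx.1
        rwa [length_greedyList] at h1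
      · exact ih m (by omega) hx.2
  choose y hyF hyB using fun n a => greedyList_nonempty hu hne (n + 1) a
  have hdist : ∀ a n m, m ≤ n → dist (y n a) (g m a) ≤ (1 / 2) ^ m := fun a n m hmn =>
    hball a n m hmn (hyB n a)
  -- Consecutive balls share the point `y (n + 1) a`.
  have hstep : ∀ a n, dist (g n a) (g (n + 1) a) ≤ 2 * (1 / 2) ^ n := by
    intro a n
    have h1 := hdist a (n + 1) n (by omega)
    have h2 := hdist a (n + 1) (n + 1) le_rfl
    have h3 : ((1 : ℝ) / 2) ^ (n + 1) ≤ (1 / 2) ^ n := by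
      rw [pow_succ]; have : (0 : ℝ) < (1 / 2) ^ n := by positivity
      linarith
    have := dist_triangle_left (g n a) (g (n + 1) a) (y (n + 1) a)
    linarith
  have hcau : ∀ a, ∃ x, Filter.Tendsto (fun n => g n a) Filter.atTop (nhds x) := fun a =>
    cauchySeq_tendsto_of_complete
      (cauchySeq_of_le_geometric (1 / 2) 2 (by norm_num) (hstep a))
  choose f hf using hcau
  refine ⟨f, measurable_of_tendsto_metrizable hg (tendsto_pi_nhds.2 hf), fun a => ?_⟩
  refine (hcl a).mem_of_tendsto (f := fun n => y n a) (b := Filter.atTop) ?_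
    (Filter.Eventually.of_forall fun n => hyF n a)
  refine (tendsto_iff_of_dist ?_).1 (hf a)
  refine squeeze_zero (fun _ => dist_nonneg) (fun n => ?_)
    (tendsto_pow_atTop_nhds_zero_of_lt_one (r := (1 / 2 : ℝ)) (by norm_num) (by norm_num))
  rw [dist_comm]
  exact hdist a n n le_rfl

/-- Measurable selection of minimisers of a Carathéodory function. -/
theorem exists_measurable_isMinOn [MeasurableSpace α] [MetricSpace X] [CompleteSpace X]
    [TopologicalSpace.SeparableSpace X] [MeasurableSpace X] [BorelSpace X] {ℓ : α → X → ℝ}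
    (hm : ∀ k, Measurable fun a => ℓ a k) {G : Set α} (hG : MeasurableSet G)
    (hc : ∀ a ∈ G, Continuous (ℓ a))
    (hmin : ∀ a ∈ G, ∀ C, IsClosed C → C.Nonempty → ∃ k ∈ C, IsMinOn (ℓ a) C k)
    {A : Set X} (hA : IsClosed A) (hne : A.Nonempty) :
    ∃ f : α → X, Measurable f ∧ ∀ a ∈ G, f a ∈ A ∧ IsMinOn (ℓ a) A (f a) := by
  have : SecondCountableTopology X := UniformSpace.secondCountable_of_separable X
  -- Off `G` every point is allowed, which keeps `F` closed and nonempty everywhere.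
  let F : α → Set X := fun a => {k | a ∈ G → k ∈ A ∧ IsMinOn (ℓ a) A k}
  suffices h : ∃ f : α → X, Measurable f ∧ ∀ a, f a ∈ F a by
    obtain ⟨f, hf, hF⟩ := h
    exact ⟨f, hf, fun a ha => hF a ha⟩
  have hbdd : ∀ a ∈ G, ∀ C, IsClosed C → BddBelow (ℓ a '' C) := by
    intro a ha C hC
    rcases C.eq_empty_or_nonempty with rfl | hCne
    · simp
    obtain ⟨k, _, hk⟩ := hmin a ha C hC hCne
    exact ⟨ℓ a k, by rintro _ ⟨k', hk', rfl⟩; exact hk hk'⟩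
  refine exists_measurable_selector (fun a => ?_) (fun a => ?_) (fun C hC => ?_)
  · by_cases ha : a ∈ G
    · obtain ⟨k, hk, hk'⟩ := hmin a ha A hA hne
      exact ⟨k, fun _ => ⟨hk, hk'⟩⟩
    · exact ⟨hne.some, fun h => absurd h ha⟩
  · by_cases ha : a ∈ G
    · have : F a = A ∩ ⋂ k ∈ A, {x | ℓ a x ≤ ℓ a k} := by
        ext x
        simp [F, ha, isMinOn_iff]
      rw [this]
      exact hA.inter (isClosed_biInter fun k _ => isClosed_le (hc a ha) continuous_const)
    · have : F a = Set.univ := by ext x; simp [F, ha]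
      rw [this]; exact isClosed_univ
  · rcases C.eq_empty_or_nonempty with rfl | hCne
    · simp
    -- An empty intersection must be set apart: the real `sInf ∅ = 0` would spoil the comparison of
    -- infima below.
    rcases (A ∩ C).eq_empty_or_nonempty with hAC | hAC
    · have : {a | (F a ∩ C).Nonempty} = Gᶜ := by
        ext a
        constructor
        · rintro ⟨k, hk, hkC⟩ ha
          have : k ∈ A ∩ C := ⟨(hk ha).1, hkC⟩
          rw [hAC] at this
          exact this
        · intro ha
          exact ⟨hCne.some, fun h => absurd h ha, hCne.some_mem⟩
      rw [this]; exact hG.compl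
    obtain ⟨D, hDA, hDc, hAD⟩ :=
      (TopologicalSpace.IsSeparable.of_separableSpace A).exists_countable_dense_subset
    obtain ⟨E, hEA, hEc, hAE⟩ :=
      (TopologicalSpace.IsSeparable.of_separableSpace (A ∩ C)).exists_countable_dense_subset
    -- On `G`, a minimiser over `A` lies in `C` exactly when the infimum over `A ∩ C`, which is
    -- attained, does not exceed that over `A`. Countable dense sets make both infima measurable.
    have : {a | (F a ∩ C).Nonempty} =
        Gᶜ ∪ (G ∩ {a | sInf ((fun k => ℓ a k) '' E) ≤ sInf ((fun k => ℓ a k) '' D)}) := by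
      ext a
      by_cases ha : a ∈ G
      · have h1 := csInf_image_eq_of_subset_closure (hc a ha) (hbdd a ha A hA) hDA hAD
        have h2 := csInf_image_eq_of_subset_closure (hc a ha)
          (hbdd a ha _ (hA.inter hC)) hEA hAE
        simp only [Set.mem_ofPred_eq, Set.mem_union, Set.mem_compl_iff, ha, not_true_eq_false,
          Set.mem_inter_iff, true_and, false_or]
        change _ ↔ sInf (ℓ a '' E) ≤ sInf (ℓ a '' D)
        rw [← h1, ← h2]
        constructor
        · rintro ⟨k, hk, hkC⟩
          obtain ⟨hkA, hkm⟩ := hk ha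
          refine (csInf_le (hbdd a ha _ (hA.inter hC)) ⟨k, ⟨hkA, hkC⟩, rfl⟩).trans ?_
          refine le_csInf (hne.image _) ?_
          rintro _ ⟨k', hk', rfl⟩
          exact hkm hk'
        · intro hle
          obtain ⟨k, hk, hkm⟩ := hmin a ha _ (hA.inter hC) hAC
          refine ⟨k, fun _ => ⟨hk.1, fun k' hk' => ?_⟩, hk.2⟩
          have h3 : ℓ a k ≤ sInf (ℓ a '' (A ∩ C)) := by
            refine le_csInf (hAC.image _) ?_
            rintro _ ⟨k', hk', rfl⟩
            exact hkm hk'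
          exact h3.trans (hle.trans (csInf_le (hbdd a ha A hA) ⟨k', hk', rfl⟩))
      · simp only [Set.mem_ofPred_eq, Set.mem_union, Set.mem_compl_iff, ha, not_false_eq_true,
          true_or, iff_true]
        exact ⟨hCne.some, fun h => absurd h ha, hCne.some_mem⟩
    rw [this]
    exact hG.compl.union (hG.inter (measurableSet_le (Measurable.sInf hEc fun k _ => hm k)
      (Measurable.sInf hDc fun k _ => hm k)))

end Selection

/-! ### Measurable dependence of the one-period problem on the state. -/

section KernelLoss

variable {N Ns : ℕ} {κ : Kernel (Fin Ns → ℝ) ((Fin N → ℝ) × (Fin Ns → ℝ))}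
  {m m' : Measure (Fin Ns → ℝ)} {dm dp : (Fin Ns → ℝ) → ℝ}

/-- The weights are only almost everywhere measurable. Hypothesis `hκ` carries `m'`-null sets back
through the kernel, so measurable versions may replace them for `m`-almost every state, for all `k`
simultaneously. -/
theorem exists_measurable_lossMinus [IsSFiniteKernel κ]
    (hκ : ∀ P : (Fin Ns → ℝ) → Prop, (∀ᵐ σ ∂m', P σ) → ∀ᵐ σ ∂m, ∀ᵐ p ∂κ σ, P p.2)
    (hm : AEMeasurable dm m') (hp : AEMeasurable dp m') :
    ∃ ℓ : (Fin Ns → ℝ) → (Fin N → ℝ) → ℝ, (∀ k, Measurable fun σ => ℓ σ k) ∧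
      ∀ᵐ σ ∂m, ℓ σ = lossMinus (κ σ) dm dp := by
  refine ⟨fun σ => lossMinus (κ σ) (hm.mk dm) (hp.mk dp), fun k => ?_, ?_⟩
  · have hd : Measurable fun p : (Fin N → ℝ) × (Fin Ns → ℝ) => p.1 ⬝ᵥ k := by
      unfold dotProduct; fun_prop
    have h : Measurable fun p : (Fin N → ℝ) × (Fin Ns → ℝ) =>
        (1 - p.1 ⬝ᵥ k) ^ 2 * (if p.1 ⬝ᵥ k ≤ 1 then hm.mk dm p.2 else hp.mk dp p.2) :=
      ((measurable_const.sub hd).pow_const 2).mul (Measurable.ite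
        (measurableSet_le hd measurable_const) (hm.measurable_mk.comp measurable_snd)
        (hp.measurable_mk.comp measurable_snd))
    exact h.stronglyMeasurable.integral_kernel.measurable
  · filter_upwards [hκ _ hm.ae_eq_mk, hκ _ hp.ae_eq_mk] with σ h1 h2
    funext k
    refine integral_congr_ae ?_
    filter_upwards [h1, h2] with p h1 h2
    rw [h1, h2]

theorem aemeasurable_sInf_lossMinus [IsMarkovKernel κ]
    (hκ : ∀ P : (Fin Ns → ℝ) → Prop, (∀ᵐ σ ∂m', P σ) → ∀ᵐ σ ∂m, ∀ᵐ p ∂κ σ, P p.2)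
    (hm : AEMeasurable dm m') (hp : AEMeasurable dp m')
    (hreg : ∀ᵐ σ ∂m, RegularStep (κ σ) dm dp) (C : Set (Fin N → ℝ)) :
    AEMeasurable (fun σ => sInf (lossMinus (κ σ) dm dp '' C)) m := by
  obtain ⟨ℓ, hℓ, hℓ'⟩ := exists_measurable_lossMinus hκ hm hp
  obtain ⟨D, hDC, hDc, hCD⟩ :=
    (TopologicalSpace.IsSeparable.of_separableSpace C).exists_countable_dense_subset
  refine ⟨fun σ => sInf ((fun k => ℓ σ k) '' D), Measurable.sInf hDc fun k _ => hℓ k, ?_⟩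
  filter_upwards [hℓ', hreg] with σ h1 h2
  rw [h1]
  exact csInf_image_eq_of_subset_closure h2.continuous_lossMinus (h2.bddBelow_lossMinus C) hDC hCD

theorem exists_measurable_isMinOn_lossMinus [IsMarkovKernel κ]
    (hκ : ∀ P : (Fin Ns → ℝ) → Prop, (∀ᵐ σ ∂m', P σ) → ∀ᵐ σ ∂m, ∀ᵐ p ∂κ σ, P p.2)
    (hm : AEMeasurable dm m') (hp : AEMeasurable dp m')
    (hreg : ∀ᵐ σ ∂m, RegularStep (κ σ) dm dp) {C : Set (Fin N → ℝ)} (hC : IsClosed C)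
    (hne : C.Nonempty) :
    ∃ f : (Fin Ns → ℝ) → (Fin N → ℝ), Measurable f ∧
      ∀ᵐ σ ∂m, f σ ∈ C ∧ IsMinOn (lossMinus (κ σ) dm dp) C (f σ) := by
  obtain ⟨ℓ, hℓ, hℓ'⟩ := exists_measurable_lossMinus hκ hm hp
  obtain ⟨G, hGsub, hGm, hG⟩ :=
    (hℓ'.and hreg : ∀ᵐ σ ∂m, _ ∧ _).exists_measurable_mem
  obtain ⟨f, hf, hfG⟩ := exists_measurable_isMinOn hℓ hGm
    (fun σ hσ => by rw [(hG σ hσ).1]; exact (hG σ hσ).2.continuous_lossMinus)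
    (fun σ hσ C hC hne => by rw [(hG σ hσ).1]; exact (hG σ hσ).2.exists_isMinOn hC hne) hC hne
  refine ⟨f, hf, ?_⟩
  filter_upwards [hGsub] with σ hσ
  have := hfG σ hσ
  rwa [(hG σ hσ).1] at this

end KernelLoss

theorem image_lossPlus {N Ns : ℕ} (ν : Measure ((Fin N → ℝ) × (Fin Ns → ℝ)))
    (dm dp : (Fin Ns → ℝ) → ℝ) (C : Set (Fin N → ℝ)) :
    lossPlus ν dm dp '' C = lossMinus ν dp dm '' (Neg.neg '' C) := by
  rw [Set.image_image]
  exact Set.image_congr fun k _ => lossPlus_eq_lossMinus_neg ν dm dp k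

/-! ### Regularity of the weights and existence of minimisers. -/

namespace FactorMarket

variable {Ω : Type*} [MeasurableSpace Ω] {μ : Measure Ω} {T N Ns Nξ : ℕ}

theorem measurable_state (M : FactorMarket μ T N Ns Nξ) {t : ℕ} (ht : t ≤ T) :
    Measurable (M.s t) := (M.s_meas t ht).mono (M.ℱ.le t) le_rfl

theorem measurable_next (M : FactorMarket μ T N Ns Nξ) {t : ℕ} (ht : t < T) :
    Measurable fun ω => (M.r (t + 1) ω, M.s (t + 1) ω) :=
  ((M.r_meas t ht).mono (M.ℱ.le _) le_rfl).prodMk (M.measurable_state ht)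

instance [IsFiniteMeasure μ] (M : FactorMarket μ T N Ns Nξ) (t : ℕ) :
    IsMarkovKernel (M.transition t) := by
  unfold transition; infer_instance

/-- The law of `s t` composed with the kernel is the joint law of `s t` and the next return and
state. Its last marginal is the law of `s (t + 1)`. -/
theorem ae_ae_transition [IsFiniteMeasure μ] (M : FactorMarket μ T N Ns Nξ) {t : ℕ} (ht : t < T)
    (P : (Fin Ns → ℝ) → Prop) (hP : ∀ᵐ σ ∂(μ.map (M.s (t + 1))), P σ) :
    ∀ᵐ σ ∂(μ.map (M.s t)), ∀ᵐ p ∂(M.transition t σ), P p.2 := by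
  refine Measure.ae_ae_of_ae_compProd
    (p := fun q : (Fin Ns → ℝ) × ((Fin N → ℝ) × (Fin Ns → ℝ)) => P q.2.2) ?_
  unfold transition
  rw [compProd_map_condDistrib (M.measurable_next ht).aemeasurable]
  have hq : Measurable fun ω => (M.s t ω, (M.r (t + 1) ω, M.s (t + 1) ω)) :=
    (M.measurable_state ht.le).prodMk (M.measurable_next ht)
  refine ae_of_ae_map (f := fun q : (Fin Ns → ℝ) × ((Fin N → ℝ) × (Fin Ns → ℝ)) => q.2.2)
    (by fun_prop) ?_
  rwa [Measure.map_map (by fun_prop) hq]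

/-- The weights of time `t` are bounded, almost surely positive, and almost everywhere
measurable functions of the state. -/
structure RegularWeights [IsFiniteMeasure μ] (M : FactorMarket μ T N Ns Nξ)
    (A : ℕ → Set (Fin N → ℝ)) (t : ℕ) : Prop where
  minus_nonneg : ∀ σ, 0 ≤ M.dMinus A t σ
  minus_le_one : ∀ σ, M.dMinus A t σ ≤ 1
  plus_nonneg : ∀ σ, 0 ≤ M.dPlus A t σ
  plus_le_one : ∀ σ, M.dPlus A t σ ≤ 1
  minus_meas : AEMeasurable (M.dMinus A t) (μ.map (M.s t))
  plus_meas : AEMeasurable (M.dPlus A t) (μ.map (M.s t))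
  minus_pos : ∀ᵐ σ ∂(μ.map (M.s t)), 0 < M.dMinus A t σ
  plus_pos : ∀ᵐ σ ∂(μ.map (M.s t)), 0 < M.dPlus A t σ

variable [IsProbabilityMeasure μ] {M : FactorMarket μ T N Ns Nξ} {A : ℕ → Set (Fin N → ℝ)}

theorem RegularWeights.regularStep (hM : M.NondegenerateReturns) {t : ℕ} (ht : t < T)
    (h : M.RegularWeights A (t + 1)) :
    ∀ᵐ σ ∂(μ.map (M.s t)),
      RegularStep (M.transition t σ) (M.dMinus A (t + 1)) (M.dPlus A (t + 1)) := by
  filter_upwards [hM t ht, M.ae_ae_transition ht _ h.minus_pos, M.ae_ae_transition ht _ h.plus_pos,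
    M.ae_ae_transition ht _ h.minus_meas.ae_eq_mk,
    M.ae_ae_transition ht _ h.plus_meas.ae_eq_mk] with σ h1 h2 h3 h4 h5
  exact ⟨h1.1, h1.2, h.minus_nonneg, h.minus_le_one, h.plus_nonneg, h.plus_le_one,
    ⟨_, h.minus_meas.measurable_mk.comp measurable_snd, h4⟩,
    ⟨_, h.plus_meas.measurable_mk.comp measurable_snd, h5⟩, h2, h3⟩

/-- Backward induction from the constant terminal weights. The upper bound comes from the position
`0`; positivity and measurability come from the one-period theory, hence only almost everywhere. -/
theorem regularWeights (hM : M.NondegenerateReturns) (hA : ∀ t < T, (0 : Fin N → ℝ) ∈ A t)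
    {t : ℕ} (ht : t ≤ T) : M.RegularWeights A t := by
  induction ht using Nat.decreasingInduction with
  | self =>
    have h1 : M.dMinus A T = fun _ => 1 := funext (M.dMinus_terminal A)
    have h2 : M.dPlus A T = fun _ => 1 := funext (M.dPlus_terminal A)
    constructor <;> simp [h1, h2]
  | of_succ t ht ih =>
    have hreg := ih.regularStep hM ht
    have hm : M.dMinus A t = fun σ => sInf (lossMinus (M.transition t σ) (M.dMinus A (t + 1))
        (M.dPlus A (t + 1)) '' A t) := funext (M.dMinus_eq A ht)
    have hp : M.dPlus A t = fun σ => sInf (lossMinus (M.transition t σ) (M.dPlus A (t + 1))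
        (M.dMinus A (t + 1)) '' (Neg.neg '' A t)) := by
      funext σ
      rw [M.dPlus_eq A ht σ]
      unfold hPlus
      rw [← image_lossPlus]
    have h0 : (0 : Fin N → ℝ) ∈ Neg.neg '' A t := ⟨0, hA t ht, neg_zero⟩
    have hAne : (A t).Nonempty := ⟨0, hA t ht⟩
    have hAne' : (Neg.neg '' A t).Nonempty := ⟨0, h0⟩
    have nonneg : ∀ (dm dp : (Fin Ns → ℝ) → ℝ) (C : Set (Fin N → ℝ)) σ, (∀ σ, 0 ≤ dm σ) →
        (∀ σ, 0 ≤ dp σ) → 0 ≤ sInf (lossMinus (M.transition t σ) dm dp '' C) := by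
      intro dm dp C σ h1 h2
      refine Real.sInf_nonneg ?_
      rintro _ ⟨k, _, rfl⟩
      exact lossMinus_nonneg _ h1 h2 k
    have le_one : ∀ (dm dp : (Fin Ns → ℝ) → ℝ) (C : Set (Fin N → ℝ)) σ, (∀ σ, 0 ≤ dm σ) →
        (∀ σ, 0 ≤ dp σ) → (∀ σ, dm σ ≤ 1) → 0 ∈ C →
        sInf (lossMinus (M.transition t σ) dm dp '' C) ≤ 1 := by
      intro dm dp C σ h1 h2 h3 h4
      have hb : BddBelow (lossMinus (M.transition t σ) dm dp '' C) :=
        ⟨0, by rintro _ ⟨k, _, rfl⟩; exact lossMinus_nonneg _ h1 h2 k⟩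
      exact (csInf_le hb ⟨0, h4, rfl⟩).trans (lossMinus_zero_le_one _ h1 h3)
    refine ⟨fun σ => ?_, fun σ => ?_, fun σ => ?_, fun σ => ?_, ?_, ?_, ?_, ?_⟩
    · rw [hm]; exact nonneg _ _ _ _ ih.minus_nonneg ih.plus_nonneg
    · rw [hm]; exact le_one _ _ _ _ ih.minus_nonneg ih.plus_nonneg ih.minus_le_one (hA t ht)
    · rw [hp]; exact nonneg _ _ _ _ ih.plus_nonneg ih.minus_nonneg
    · rw [hp]; exact le_one _ _ _ _ ih.plus_nonneg ih.minus_nonneg ih.plus_le_one h0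
    · rw [hm]
      exact aemeasurable_sInf_lossMinus (M.ae_ae_transition ht) ih.minus_meas ih.plus_meas hreg _
    · rw [hp]
      exact aemeasurable_sInf_lossMinus (M.ae_ae_transition ht) ih.plus_meas ih.minus_meas
        (hreg.mono fun σ h => h.swap) _
    · rw [hm]
      filter_upwards [hreg] with σ h
      exact h.sInf_lossMinus_pos hAne
    · rw [hp]
      filter_upwards [hreg] with σ h
      exact h.swap.sInf_lossMinus_pos hAne'

theorem ae_regularStep (hM : M.NondegenerateReturns) (hA : ∀ t < T, (0 : Fin N → ℝ) ∈ A t)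
    {t : ℕ} (ht : t < T) :
    ∀ᵐ σ ∂(μ.map (M.s t)),
      RegularStep (M.transition t σ) (M.dMinus A (t + 1)) (M.dPlus A (t + 1)) :=
  (regularWeights hM hA (Nat.succ_le_of_lt ht)).regularStep hM ht

/-- For closed cones, measurable minimisers exist. -/
theorem exists_isAllocation (hM : M.NondegenerateReturns)
    (hA : ∀ t < T, (0 : Fin N → ℝ) ∈ A t) (hcl : ∀ t < T, IsClosed (A t)) :
    ∃ km kp, M.IsAllocation A km kp := by
  have hm : ∀ t, ∃ f : (Fin Ns → ℝ) → (Fin N → ℝ), t < T → Measurable f ∧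
      ∀ᵐ σ ∂(μ.map (M.s t)), f σ ∈ A t ∧ IsMinOn (M.hMinus A t σ) (A t) (f σ) := by
    intro t
    by_cases ht : t < T
    · have hw := regularWeights hM hA (Nat.succ_le_of_lt ht)
      obtain ⟨f, hf⟩ := exists_measurable_isMinOn_lossMinus (M.ae_ae_transition ht)
        hw.minus_meas hw.plus_meas (hw.regularStep hM ht) (hcl t ht) ⟨0, hA t ht⟩
      exact ⟨f, fun _ => hf⟩
    · exact ⟨0, fun h => absurd h ht⟩
  have hp : ∀ t, ∃ f : (Fin Ns → ℝ) → (Fin N → ℝ), t < T → Measurable f ∧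
      ∀ᵐ σ ∂(μ.map (M.s t)), f σ ∈ A t ∧ IsMinOn (M.hPlus A t σ) (A t) (f σ) := by
    intro t
    by_cases ht : t < T
    · have hw := regularWeights hM hA (Nat.succ_le_of_lt ht)
      have hcl' : IsClosed (Neg.neg ⁻¹' A t) := (hcl t ht).preimage continuous_neg
      obtain ⟨f, hf, hf'⟩ := exists_measurable_isMinOn_lossMinus (M.ae_ae_transition ht)
        hw.plus_meas hw.minus_meas ((hw.regularStep hM ht).mono fun σ h => h.swap)
        hcl' ⟨0, by simpa using hA t ht⟩
      refine ⟨fun σ => -f σ, fun _ => ⟨hf.neg, ?_⟩⟩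
      filter_upwards [hf'] with σ hσ
      refine ⟨hσ.1, fun k hk => ?_⟩
      have h1 : lossMinus (M.transition t σ) (M.dPlus A (t + 1)) (M.dMinus A (t + 1)) (f σ) ≤
          lossMinus (M.transition t σ) (M.dPlus A (t + 1)) (M.dMinus A (t + 1)) (-k) :=
        hσ.2 (by simpa using hk)
      simpa [hPlus, lossPlus_eq_lossMinus_neg] using h1
    · exact ⟨0, fun h => absurd h ht⟩
  choose km hkm using hm
  choose kp hkp using hp
  refine ⟨km, kp, fun t ht => ⟨(hkm t ht).1, (hkp t ht).1, ?_⟩⟩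
  filter_upwards [(hkm t ht).2, (hkp t ht).2] with σ h1 h2
  exact ⟨⟨h1.1, fun k hk => h1.2 hk⟩, ⟨h2.1, fun k hk => h2.2 hk⟩⟩

end FactorMarket

/-! ### Dynamic programming for the quadratic target problem. -/

namespace FactorMarket

variable {Ω : Type*} [MeasurableSpace Ω] {μ : Measure Ω} {T N Ns Nξ : ℕ}

section Law

variable [IsProbabilityMeasure μ] (M : FactorMarket μ T N Ns Nξ) {𝒵 : Type*} [MeasurableSpace 𝒵]

/-- By the Markov property, the law of the next return and state given any information `Z`
available at time `t` that includes the current state is given by the transition kernel. -/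
theorem map_prodMk_next_eq_compProd {t : ℕ} (ht : t < T) {Z : Ω → 𝒵} (hZ : Measurable[M.ℱ t] Z)
    {q : 𝒵 → (Fin Ns → ℝ)} (hq : Measurable q) (hqZ : ∀ ω, q (Z ω) = M.s t ω) :
    μ.map (fun ω => (Z ω, (M.r (t + 1) ω, M.s (t + 1) ω))) =
      (μ.map Z) ⊗ₘ ((M.transition t).comap q hq) := by
  have hZ' : Measurable Z := hZ.mono (M.ℱ.le t) le_rfl
  have hY := M.measurable_next ht
  have : IsProbabilityMeasure (μ.map Z) := Measure.isProbabilityMeasure_map hZ'.aemeasurable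
  have : IsProbabilityMeasure (μ.map (fun ω => (Z ω, (M.r (t + 1) ω, M.s (t + 1) ω)))) :=
    Measure.isProbabilityMeasure_map (hZ'.prodMk hY).aemeasurable
  refine Measure.ext_prod fun {S B} hS hB => ?_
  rw [Measure.map_apply (hZ'.prodMk hY) (hS.prod hB), Measure.compProd_apply_prod hS hB]
  have hmeas : Measurable fun z => ((M.transition t).comap q hq) z B := Kernel.measurable_coe _ hB
  rw [setLIntegral_map hS hmeas hZ']
  simp only [Kernel.comap_apply, hqZ]
  have hi : Integrable (((fun ω => (M.r (t + 1) ω, M.s (t + 1) ω)) ⁻¹' B).indicator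
      (fun _ => (1 : ℝ))) μ := (integrable_const _).indicator (hY hB)
  have hae := condDistrib_ae_eq_condExp (μ := μ) (M.measurable_state ht.le) hY hB
  -- The kernel gives the conditional probability given `s t`, which by `markov` is also the one
  -- given `ℱ t`; the event `Z ⁻¹' S` lies in `ℱ t`.
  have hreal : ∫ ω in Z ⁻¹' S, (M.transition t (M.s t ω)).real B ∂μ =
      μ.real (Z ⁻¹' S ∩ (fun ω => (M.r (t + 1) ω, M.s (t + 1) ω)) ⁻¹' B) := by
    rw [setIntegral_congr_ae (g := μ[((fun ω => (M.r (t + 1) ω, M.s (t + 1) ω)) ⁻¹' B).indicator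
      (fun _ => (1 : ℝ)) | M.ℱ t]) (hZ' hS), setIntegral_condExp (M.ℱ.le t) hi (hZ hS),
      setIntegral_indicator (hY hB)]
    · simp
    · filter_upwards [hae, M.markov t ht B hB] with ω h1 h2 _
      exact h1.trans h2.symm
  have hmeas' : Measurable fun ω => M.transition t (M.s t ω) B :=
    (Kernel.measurable_coe _ hB).comp (M.measurable_state ht.le)
  simp only [Measure.real] at hreal
  rw [integral_toReal hmeas'.aemeasurable (ae_of_all _ fun ω => measure_lt_top _ _)] at hreal
  have hfin : ∫⁻ ω in Z ⁻¹' S, M.transition t (M.s t ω) B ∂μ ≠ ⊤ := by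
    refine ne_top_of_le_ne_top (b := ∫⁻ _ in Z ⁻¹' S, 1 ∂μ) (by simp) ?_
    exact lintegral_mono fun ω => prob_le_one
  exact ((ENNReal.toReal_eq_toReal_iff' hfin (measure_ne_top _ _)).1 hreal).symm

/-- The tower property. Stating it for `∫⁻` avoids assuming that intermediate wealth is square
integrable. -/
theorem lintegral_next {t : ℕ} (ht : t < T) {Z : Ω → 𝒵} (hZ : Measurable[M.ℱ t] Z)
    {q : 𝒵 → (Fin Ns → ℝ)} (hq : Measurable q) (hqZ : ∀ ω, q (Z ω) = M.s t ω)
    {F : 𝒵 × ((Fin N → ℝ) × (Fin Ns → ℝ)) → ENNReal}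
    (hF : AEMeasurable F (μ.map (fun ω => (Z ω, (M.r (t + 1) ω, M.s (t + 1) ω))))) :
    ∫⁻ ω, F (Z ω, (M.r (t + 1) ω, M.s (t + 1) ω)) ∂μ =
      ∫⁻ ω, ∫⁻ p, F (Z ω, p) ∂(M.transition t (M.s t ω)) ∂μ := by
  have hZ' : Measurable Z := hZ.mono (M.ℱ.le t) le_rfl
  have hY := M.measurable_next ht
  have : IsProbabilityMeasure (μ.map Z) := Measure.isProbabilityMeasure_map hZ'.aemeasurable
  have hlaw := M.map_prodMk_next_eq_compProd ht hZ hq hqZ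
  obtain ⟨G, hG, hmk⟩ := hF
  have hmk' := hmk
  rw [hlaw] at hmk'
  rw [lintegral_congr_ae (ae_of_ae_map (hZ'.prodMk hY).aemeasurable hmk),
    ← lintegral_map hG (hZ'.prodMk hY)]
  conv_lhs => rw [hlaw]
  rw [Measure.lintegral_compProd hG,
    lintegral_map (Measurable.lintegral_kernel_prod_right' hG) hZ']
  refine lintegral_congr_ae ?_
  filter_upwards [ae_of_ae_map hZ'.aemeasurable (Measure.ae_ae_of_ae_compProd hmk')] with ω hω
  simp only [Kernel.comap_apply, hqZ] at hω ⊢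
  exact (lintegral_congr_ae hω).symm

end Law

theorem rho_eq_mul (M : FactorMarket μ T N Ns Nξ) {t : ℕ} (ht : t < T) :
    M.rho t = M.r0 (t + 1) * M.rho (t + 1) :=
  Finset.prod_eq_prod_Ico_succ_bot ht _

theorem rho_terminal (M : FactorMarket μ T N Ns Nξ) : M.rho T = 1 := by simp [rho]

theorem rho_pos (M : FactorMarket μ T N Ns Nξ) (t : ℕ) : 0 < M.rho t :=
  Finset.prod_pos fun k hk => M.r0_pos k (Finset.mem_Ico.1 hk).2

theorem measurable_wealth (M : FactorMarket μ T N Ns Nξ) {x₀ : ℝ} {π : ℕ → Ω → (Fin N → ℝ)}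
    (hπ : ∀ t < T, Measurable[M.ℱ t] (π t)) {t : ℕ} (ht : t ≤ T) :
    Measurable[M.ℱ t] (M.wealth x₀ π t) := by
  induction t with
  | zero => exact measurable_const
  | succ t ih =>
    have h1 : Measurable[M.ℱ (t + 1)] (M.wealth x₀ π t) :=
      (ih (by omega)).mono (M.ℱ.mono t.le_succ) le_rfl
    have h2 : Measurable[M.ℱ (t + 1)] (π t) := (hπ t ht).mono (M.ℱ.mono t.le_succ) le_rfl
    have h3 := M.r_meas t ht
    have hd : Measurable fun q : (Fin N → ℝ) × (Fin N → ℝ) => q.1 ⬝ᵥ q.2 := by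
      unfold dotProduct; fun_prop
    exact (h1.const_mul _).add (hd.comp (h3.prodMk h2))

section Value

variable [IsProbabilityMeasure μ] (M : FactorMarket μ T N Ns Nξ) (A : ℕ → Set (Fin N → ℝ))

/-- Value function of the problem of steering the discounted wealth to its target, as a function
of the distance `y` to the target and of the state. -/
def value (t : ℕ) (y : ℝ) (σ : Fin Ns → ℝ) : ℝ :=
  (min y 0) ^ 2 * M.dMinus A t σ + (max y 0) ^ 2 * M.dPlus A t σ

variable {M A}

theorem value_of_nonpos {y : ℝ} (hy : y ≤ 0) (t : ℕ) (σ : Fin Ns → ℝ) :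
    M.value A t y σ = y ^ 2 * M.dMinus A t σ := by
  simp [value, hy]

theorem value_of_nonneg {y : ℝ} (hy : 0 ≤ y) (t : ℕ) (σ : Fin Ns → ℝ) :
    M.value A t y σ = y ^ 2 * M.dPlus A t σ := by
  simp [value, hy]

theorem value_terminal (y : ℝ) (σ : Fin Ns → ℝ) : M.value A T y σ = y ^ 2 := by
  rcases le_total y 0 with hy | hy
  · simp [value_of_nonpos hy, dMinus_terminal]
  · simp [value_of_nonneg hy, dPlus_terminal]

/-- From below the target, the gap overshoots only if `r ⬝ᵥ k > 1`, precisely where the loss changes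
weight. -/
theorem value_mul_one_sub {y : ℝ} (hy : y ≤ 0) (t : ℕ) (k : Fin N → ℝ)
    (p : (Fin N → ℝ) × (Fin Ns → ℝ)) : M.value A t (y * (1 - p.1 ⬝ᵥ k)) p.2 =
      y ^ 2 * lossIntegrand (M.dMinus A t) (M.dPlus A t) k p := by
  unfold lossIntegrand
  split_ifs with h
  · rw [value_of_nonpos (mul_nonpos_of_nonpos_of_nonneg hy (by linarith))]; ring
  · rw [value_of_nonneg (mul_nonneg_of_nonpos_of_nonpos hy (by linarith))]; ring

theorem value_mul_one_add {y : ℝ} (hy : 0 ≤ y) (t : ℕ) (k : Fin N → ℝ)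
    (p : (Fin N → ℝ) × (Fin Ns → ℝ)) : M.value A t (y * (1 + p.1 ⬝ᵥ k)) p.2 =
      y ^ 2 * lossIntegrand (M.dPlus A t) (M.dMinus A t) (-k) p := by
  unfold lossIntegrand
  rw [dotProduct_neg]
  split_ifs with h
  · rw [value_of_nonneg (mul_nonneg hy (by linarith))]; ring
  · rw [value_of_nonpos (mul_nonpos_of_nonneg_of_nonpos hy (by linarith))]; ring

theorem lintegral_value_mul_one_sub {t : ℕ} {σ : Fin Ns → ℝ}
    (h : RegularStep (M.transition t σ) (M.dMinus A (t + 1)) (M.dPlus A (t + 1)))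
    {y : ℝ} (hy : y ≤ 0) (k : Fin N → ℝ) :
    ∫⁻ p, ENNReal.ofReal (M.value A (t + 1) (y * (1 - p.1 ⬝ᵥ k)) p.2) ∂(M.transition t σ) =
      ENNReal.ofReal (y ^ 2 * M.hMinus A t σ k) := by
  simp only [value_mul_one_sub hy]
  rw [← ofReal_integral_eq_lintegral_ofReal ((h.integrable_lossIntegrand k).const_mul _)
    (ae_of_all _ fun p => mul_nonneg (sq_nonneg _)
      (lossIntegrand_nonneg h.minus_nonneg h.plus_nonneg k p)), integral_const_mul]
  rfl

theorem lintegral_value_mul_one_add {t : ℕ} {σ : Fin Ns → ℝ}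
    (h : RegularStep (M.transition t σ) (M.dMinus A (t + 1)) (M.dPlus A (t + 1)))
    {y : ℝ} (hy : 0 ≤ y) (k : Fin N → ℝ) :
    ∫⁻ p, ENNReal.ofReal (M.value A (t + 1) (y * (1 + p.1 ⬝ᵥ k)) p.2) ∂(M.transition t σ) =
      ENNReal.ofReal (y ^ 2 * M.hPlus A t σ k) := by
  simp only [value_mul_one_add hy]
  rw [← ofReal_integral_eq_lintegral_ofReal ((h.swap.integrable_lossIntegrand (-k)).const_mul _)
    (ae_of_all _ fun p => mul_nonneg (sq_nonneg _)
      (lossIntegrand_nonneg h.plus_nonneg h.minus_nonneg (-k) p)), integral_const_mul, hPlus,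
      lossPlus_eq_lossMinus_neg]
  rfl

/-- No position in the cone improves on the value function over one period. -/
theorem value_le_lintegral {t : ℕ} (ht : t < T) {σ : Fin Ns → ℝ}
    (h : RegularStep (M.transition t σ) (M.dMinus A (t + 1)) (M.dPlus A (t + 1)))
    (hcone : ∀ α : ℝ, 0 < α → ∀ k ∈ A t, α • k ∈ A t) (y : ℝ) {c : ℝ} (hc : 0 < c)
    {k : Fin N → ℝ} (hk : k ∈ A t) :
    ENNReal.ofReal (M.value A t y σ) ≤
      ∫⁻ p, ENNReal.ofReal (M.value A (t + 1) (y + c * (p.1 ⬝ᵥ k)) p.2) ∂(M.transition t σ) := by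
  rcases lt_trichotomy y 0 with hy | rfl | hy
  · have hk' := hcone (c / -y) (div_pos hc (neg_pos.2 hy)) k hk
    have he : ∀ r : Fin N → ℝ, y + c * (r ⬝ᵥ k) = y * (1 - r ⬝ᵥ ((c / -y) • k)) := by
      intro r
      have := hy.ne
      rw [dotProduct_smul, smul_eq_mul, div_neg]
      field_simp
      ring
    simp only [he]
    rw [lintegral_value_mul_one_sub h hy.le, value_of_nonpos hy.le, M.dMinus_eq A ht]
    refine ENNReal.ofReal_le_ofReal (mul_le_mul_of_nonneg_left ?_ (sq_nonneg _))
    exact csInf_le (h.bddBelow_lossMinus _) ⟨_, hk', rfl⟩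
  -- At the target the value is zero, so no scaling is needed.
  · simp [value]
  · have hk' := hcone (c / y) (div_pos hc hy) k hk
    have he : ∀ r : Fin N → ℝ, y + c * (r ⬝ᵥ k) = y * (1 + r ⬝ᵥ ((c / y) • k)) := by
      intro r
      rw [dotProduct_smul, smul_eq_mul]
      field_simp
    simp only [he]
    rw [lintegral_value_mul_one_add h hy.le, value_of_nonneg hy.le, M.dPlus_eq A ht]
    refine ENNReal.ofReal_le_ofReal (mul_le_mul_of_nonneg_left ?_ (sq_nonneg _))
    refine csInf_le ⟨0, ?_⟩ ⟨_, hk', rfl⟩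
    rintro _ ⟨k', _, rfl⟩
    rw [hPlus, lossPlus_eq_lossMinus_neg]
    exact lossMinus_nonneg _ h.plus_nonneg h.minus_nonneg _

/-- Expected value of the value function along the wealth process of `π`. -/
def expectedValue (M : FactorMarket μ T N Ns Nξ) (A : ℕ → Set (Fin N → ℝ)) (x₀ γ : ℝ)
    (π : ℕ → Ω → (Fin N → ℝ)) (t : ℕ) : ENNReal :=
  ∫⁻ ω, ENNReal.ofReal (M.value A t (M.rho t * M.wealth x₀ π t ω - γ) (M.s t ω)) ∂μ

theorem expectedValue_terminal (x₀ γ : ℝ) (π : ℕ → Ω → (Fin N → ℝ)) :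
    M.expectedValue A x₀ γ π T = ∫⁻ ω, ENNReal.ofReal ((M.wealth x₀ π T ω - γ) ^ 2) ∂μ := by
  simp [expectedValue, value_terminal, rho_terminal]

theorem expectedValue_zero (x₀ γ : ℝ) (π : ℕ → Ω → (Fin N → ℝ)) :
    M.expectedValue A x₀ γ π 0 = ENNReal.ofReal (M.value A 0 (M.rho 0 * x₀ - γ) M.s₀) := by
  simp [expectedValue, M.s_zero, wealth]

theorem expectedValue_succ (hM : M.NondegenerateReturns)
    (hA : ∀ t < T, (0 : Fin N → ℝ) ∈ A t) {x₀ γ : ℝ} {π : ℕ → Ω → (Fin N → ℝ)}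
    (hπ : ∀ t < T, Measurable[M.ℱ t] (π t)) {t : ℕ} (ht : t < T) :
    M.expectedValue A x₀ γ π (t + 1) =
      ∫⁻ ω, ∫⁻ p, ENNReal.ofReal (M.value A (t + 1)
        ((M.rho t * M.wealth x₀ π t ω - γ) + M.rho (t + 1) * (p.1 ⬝ᵥ π t ω)) p.2)
        ∂(M.transition t (M.s t ω)) ∂μ := by
  have hw := regularWeights hM hA (Nat.succ_le_of_lt ht)
  have hZ : Measurable[M.ℱ t] fun ω => (M.wealth x₀ π t ω, π t ω, M.s t ω) :=
    (M.measurable_wealth hπ ht.le).prodMk ((hπ t ht).prodMk (M.s_meas t ht.le))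
  have hZY : Measurable fun ω => ((M.wealth x₀ π t ω, π t ω, M.s t ω),
      (M.r (t + 1) ω, M.s (t + 1) ω)) :=
    (hZ.mono (M.ℱ.le t) le_rfl).prodMk (M.measurable_next ht)
  let F : (ℝ × (Fin N → ℝ) × (Fin Ns → ℝ)) × ((Fin N → ℝ) × (Fin Ns → ℝ)) → ENNReal := fun q =>
    ENNReal.ofReal (M.value A (t + 1)
      ((M.rho t * q.1.1 - γ) + M.rho (t + 1) * (q.2.1 ⬝ᵥ q.1.2.1)) q.2.2)
  have hF : AEMeasurable F (μ.map fun ω => ((M.wealth x₀ π t ω, π t ω, M.s t ω),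
      (M.r (t + 1) ω, M.s (t + 1) ω))) := by
    have hs : Measurable fun q : (ℝ × (Fin N → ℝ) × (Fin Ns → ℝ)) ×
        ((Fin N → ℝ) × (Fin Ns → ℝ)) => q.2.2 := by fun_prop
    have hmap : (μ.map fun ω => ((M.wealth x₀ π t ω, π t ω, M.s t ω),
        (M.r (t + 1) ω, M.s (t + 1) ω))).map (fun q => q.2.2) = μ.map (M.s (t + 1)) :=
      Measure.map_map hs hZY
    have h1 : AEMeasurable (fun q : (ℝ × (Fin N → ℝ) × (Fin Ns → ℝ)) ×
        ((Fin N → ℝ) × (Fin Ns → ℝ)) => M.dMinus A (t + 1) q.2.2)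
        (μ.map fun ω => ((M.wealth x₀ π t ω, π t ω, M.s t ω),
          (M.r (t + 1) ω, M.s (t + 1) ω))) :=
      AEMeasurable.comp_measurable (by rw [hmap]; exact hw.minus_meas) hs
    have h2 : AEMeasurable (fun q : (ℝ × (Fin N → ℝ) × (Fin Ns → ℝ)) ×
        ((Fin N → ℝ) × (Fin Ns → ℝ)) => M.dPlus A (t + 1) q.2.2)
        (μ.map fun ω => ((M.wealth x₀ π t ω, π t ω, M.s t ω),
          (M.r (t + 1) ω, M.s (t + 1) ω))) :=
      AEMeasurable.comp_measurable (by rw [hmap]; exact hw.plus_meas) hs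
    have h3 : Measurable fun q : (ℝ × (Fin N → ℝ) × (Fin Ns → ℝ)) ×
        ((Fin N → ℝ) × (Fin Ns → ℝ)) =>
        (M.rho t * q.1.1 - γ) + M.rho (t + 1) * (q.2.1 ⬝ᵥ q.1.2.1) := by
      unfold dotProduct; fun_prop
    exact ((((h3.min measurable_const).pow_const 2).aemeasurable.mul h1).add
      (((h3.max measurable_const).pow_const 2).aemeasurable.mul h2)).ennreal_ofReal
  have := M.lintegral_next ht hZ (q := fun z => z.2.2) (by fun_prop) (fun ω => rfl) hF
  rw [← this]
  unfold expectedValue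
  congr 1
  funext ω
  simp only [F, wealth, M.rho_eq_mul ht]
  congr 2
  ring

/-- Along an admissible process the expected value of the value function does not decrease. -/
theorem expectedValue_le_succ (hM : M.NondegenerateReturns)
    (hA : ∀ t < T, (0 : Fin N → ℝ) ∈ A t)
    (hcone : ∀ t < T, ∀ α : ℝ, 0 < α → ∀ k ∈ A t, α • k ∈ A t)
    {x₀ : ℝ} (γ : ℝ) {π : ℕ → Ω → (Fin N → ℝ)} (hπ : M.Admissible A x₀ π) {t : ℕ} (ht : t < T) :
    M.expectedValue A x₀ γ π t ≤ M.expectedValue A x₀ γ π (t + 1) := by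
  rw [expectedValue_succ hM hA (fun t ht => (hπ.1 t ht).1) ht]
  refine lintegral_mono_ae ?_
  filter_upwards [(hπ.1 t ht).2, ae_of_ae_map (M.measurable_state ht.le).aemeasurable
    (ae_regularStep hM hA ht)] with ω h1 h2
  exact value_le_lintegral ht h2 (hcone t ht) _ (M.rho_pos _) h1

theorem expectedValue_zero_le_terminal (hM : M.NondegenerateReturns)
    (hA : ∀ t < T, (0 : Fin N → ℝ) ∈ A t)
    (hcone : ∀ t < T, ∀ α : ℝ, 0 < α → ∀ k ∈ A t, α • k ∈ A t)
    {x₀ : ℝ} (γ : ℝ) {π : ℕ → Ω → (Fin N → ℝ)} (hπ : M.Admissible A x₀ π) {t : ℕ} (ht : t ≤ T) :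
    M.expectedValue A x₀ γ π 0 ≤ M.expectedValue A x₀ γ π t := by
  induction t with
  | zero => rfl
  | succ t ih =>
    exact (ih (by omega)).trans (expectedValue_le_succ hM hA hcone γ hπ ht)

end Value

section OptimalPolicy

/-- In terms of the gap to `ρ₀x₀ + λ/d`, both branches are nonnegative multiples of the minimisers.
This shows cone membership and the matching with `value`. -/
theorem optPolicy_eq {M : FactorMarket μ T N Ns Nξ} {x₀ lam d : ℝ}
    {km kp : ℕ → (Fin Ns → ℝ) → (Fin N → ℝ)} (hd : d ≠ 0) {t : ℕ} (ht : t < T)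
    (x : ℝ) (σ : Fin Ns → ℝ) :
    M.optPolicy x₀ lam d km kp t x σ =
      if M.rho t * x - (M.rho 0 * x₀ + lam / d) ≤ 0 then
        (-(M.rho t * x - (M.rho 0 * x₀ + lam / d)) / M.rho (t + 1)) • km t σ
      else ((M.rho t * x - (M.rho 0 * x₀ + lam / d)) / M.rho (t + 1)) • kp t σ := by
  have hρ := (M.rho_pos (t + 1)).ne'
  have he : M.r0 (t + 1) * x - (M.rho 0 * x₀ * d + lam) / (M.rho (t + 1) * d) =
      (M.rho t * x - (M.rho 0 * x₀ + lam / d)) / M.rho (t + 1) := by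
    rw [M.rho_eq_mul ht]
    field_simp
  unfold optPolicy
  rw [he, ← neg_smul, neg_div]
  simp only [sub_nonpos]

variable [IsProbabilityMeasure μ] {M : FactorMarket μ T N Ns Nξ} {A : ℕ → Set (Fin N → ℝ)}
  {x₀ lam d : ℝ} {km kp : ℕ → (Fin Ns → ℝ) → (Fin N → ℝ)}

theorem measurable_optPolicy (hk : M.IsAllocation A km kp) {t : ℕ} (ht : t < T) :
    Measurable fun q : ℝ × (Fin Ns → ℝ) => M.optPolicy x₀ lam d km kp t q.1 q.2 := by
  obtain ⟨hm, hp, _⟩ := hk t ht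
  unfold optPolicy
  refine Measurable.ite (measurableSet_le (by fun_prop) measurable_const) ?_ ?_ <;> fun_prop

theorem measurable_feedbackWealth (hk : M.IsAllocation A km kp) {t : ℕ} (ht : t ≤ T) :
    Measurable[M.ℱ t] (M.feedbackWealth x₀ (M.optPolicy x₀ lam d km kp) t) := by
  induction t with
  | zero => exact measurable_const
  | succ t ih =>
    have h1 : Measurable[M.ℱ (t + 1)] (M.feedbackWealth x₀ (M.optPolicy x₀ lam d km kp) t) :=
      (ih (by omega)).mono (M.ℱ.mono t.le_succ) le_rfl
    have h2 : Measurable[M.ℱ (t + 1)] (M.s t) :=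
      (M.s_meas t (by omega)).mono (M.ℱ.mono t.le_succ) le_rfl
    have hd : Measurable fun q : (Fin N → ℝ) × (Fin N → ℝ) => q.1 ⬝ᵥ q.2 := by
      unfold dotProduct; fun_prop
    exact (h1.const_mul _).add (hd.comp ((M.r_meas t ht).prodMk
      ((measurable_optPolicy hk ht).comp (h1.prodMk h2))))

theorem measurable_feedbackPortfolio (hk : M.IsAllocation A km kp) {t : ℕ} (ht : t < T) :
    Measurable[M.ℱ t] (M.feedbackPortfolio x₀ (M.optPolicy x₀ lam d km kp) t) :=
  (measurable_optPolicy hk ht).comp ((measurable_feedbackWealth hk ht.le).prodMk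
    (M.s_meas t ht.le))

theorem feedbackPortfolio_mem (hd : d ≠ 0) (hA : ∀ t < T, (0 : Fin N → ℝ) ∈ A t)
    (hcone : ∀ t < T, ∀ α : ℝ, 0 < α → ∀ k ∈ A t, α • k ∈ A t)
    (hk : M.IsAllocation A km kp) {t : ℕ} (ht : t < T) :
    ∀ᵐ ω ∂μ, M.feedbackPortfolio x₀ (M.optPolicy x₀ lam d km kp) t ω ∈ A t := by
  have hsmul : ∀ α : ℝ, 0 ≤ α → ∀ k ∈ A t, α • k ∈ A t := by
    intro α hα k hk
    rcases hα.eq_or_lt with rfl | hα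
    · rw [zero_smul]; exact hA t ht
    · exact hcone t ht α hα k hk
  filter_upwards [ae_of_ae_map (M.measurable_state ht.le).aemeasurable (hk t ht).2.2] with ω hω
  unfold feedbackPortfolio
  rw [optPolicy_eq hd ht]
  have hρ := M.rho_pos (t + 1)
  split_ifs with hy
  · exact hsmul _ (div_nonneg (by linarith) hρ.le) _ hω.1.1
  · exact hsmul _ (div_nonneg (by linarith) hρ.le) _ hω.2.1

/-- Under the feedback policy the expected value of the value function is constant. -/
theorem expectedValue_succ_optPolicy (hM : M.NondegenerateReturns) (hd : d ≠ 0)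
    (hA : ∀ t < T, (0 : Fin N → ℝ) ∈ A t) (hk : M.IsAllocation A km kp) {t : ℕ} (ht : t < T) :
    M.expectedValue A x₀ (M.rho 0 * x₀ + lam / d)
        (M.feedbackPortfolio x₀ (M.optPolicy x₀ lam d km kp)) (t + 1) =
      M.expectedValue A x₀ (M.rho 0 * x₀ + lam / d)
        (M.feedbackPortfolio x₀ (M.optPolicy x₀ lam d km kp)) t := by
  rw [expectedValue_succ hM hA (fun t ht => measurable_feedbackPortfolio hk ht) ht]
  refine lintegral_congr_ae ?_
  have hs := (M.measurable_state ht.le).aemeasurable (μ := μ)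
  filter_upwards [ae_of_ae_map hs (hk t ht).2.2, ae_of_ae_map hs (ae_regularStep hM hA ht)]
    with ω h1 h2
  rw [wealth_feedbackPortfolio]
  unfold feedbackPortfolio
  rw [optPolicy_eq hd ht]
  set y := M.rho t * M.feedbackWealth x₀ (M.optPolicy x₀ lam d km kp) t ω -
    (M.rho 0 * x₀ + lam / d)
  have hρ := (M.rho_pos (t + 1)).ne'
  split_ifs with hy
  · have he : ∀ r : Fin N → ℝ, y + M.rho (t + 1) * (r ⬝ᵥ ((-y / M.rho (t + 1)) • km t (M.s t ω)))
        = y * (1 - r ⬝ᵥ km t (M.s t ω)) := by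
      intro r
      rw [dotProduct_smul, smul_eq_mul]
      field_simp
      ring
    simp only [he]
    rw [lintegral_value_mul_one_sub h2 hy, value_of_nonpos hy, M.dMinus_eq A ht]
    have : IsLeast (M.hMinus A t (M.s t ω) '' A t) (M.hMinus A t (M.s t ω) (km t (M.s t ω))) :=
      ⟨⟨_, h1.1.1, rfl⟩, by rintro _ ⟨k, hk, rfl⟩; exact h1.1.2 k hk⟩
    rw [this.csInf_eq]
  · have hy' : 0 ≤ y := (not_le.1 hy).le
    have he : ∀ r : Fin N → ℝ, y + M.rho (t + 1) * (r ⬝ᵥ ((y / M.rho (t + 1)) • kp t (M.s t ω)))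
        = y * (1 + r ⬝ᵥ kp t (M.s t ω)) := by
      intro r
      rw [dotProduct_smul, smul_eq_mul]
      field_simp
    simp only [he]
    rw [lintegral_value_mul_one_add h2 hy', value_of_nonneg hy', M.dPlus_eq A ht]
    have : IsLeast (M.hPlus A t (M.s t ω) '' A t) (M.hPlus A t (M.s t ω) (kp t (M.s t ω))) :=
      ⟨⟨_, h1.2.1, rfl⟩, by rintro _ ⟨k, hk, rfl⟩; exact h1.2.2 k hk⟩
    rw [this.csInf_eq]

theorem expectedValue_optPolicy (hM : M.NondegenerateReturns) (hd : d ≠ 0)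
    (hA : ∀ t < T, (0 : Fin N → ℝ) ∈ A t) (hk : M.IsAllocation A km kp) {t : ℕ} (ht : t ≤ T) :
    M.expectedValue A x₀ (M.rho 0 * x₀ + lam / d)
        (M.feedbackPortfolio x₀ (M.optPolicy x₀ lam d km kp)) t =
      M.expectedValue A x₀ (M.rho 0 * x₀ + lam / d)
        (M.feedbackPortfolio x₀ (M.optPolicy x₀ lam d km kp)) 0 := by
  induction t with
  | zero => rfl
  | succ t ih => rw [expectedValue_succ_optPolicy hM hd hA hk ht, ih (by omega)]

end OptimalPolicy

end FactorMarket

/-! ### Scalar quadratic inequalities. -/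

section Quadratic

/-- First-order condition at the interior minimiser `α = 1`. -/
theorem add_mul_sub_eq_zero_of_scaling_le {v m a : ℝ} (hv : 0 ≤ v)
    (h : ∀ α, 0 ≤ α → v + (m - a) ^ 2 ≤ α ^ 2 * v + (α * m - a) ^ 2) : v + m * (m - a) = 0 := by
  by_contra hne
  set e := v + m * (m - a) with he
  have hc : 0 ≤ v + m ^ 2 := by positivity
  have hD : 0 < v + m ^ 2 + |e| := add_pos_of_nonneg_of_pos hc (abs_pos.2 hne)
  -- Half the derivative at `1` is `e`, so `1 - e / D` moves downhill. The term `|e|` keeps this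
  -- factor nonnegative.
  set D := v + m ^ 2 + |e| with hDdef
  have hα : 0 ≤ 1 - e / D := by
    have : e / D ≤ 1 := (div_le_one hD).2 ((le_abs_self e).trans (by linarith))
    linarith
  have h1 := h _ hα
  have h2 : (1 - e / D) ^ 2 * v + ((1 - e / D) * m - a) ^ 2 - (v + (m - a) ^ 2) =
      -(e / D) ^ 2 * (D + |e|) := by
    have h3 : e = e / D * D := (div_mul_cancel₀ e hD.ne').symm
    set q := e / D
    have h4 : (1 - q) ^ 2 * v + ((1 - q) * m - a) ^ 2 - (v + (m - a) ^ 2) =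
        q ^ 2 * (v + m ^ 2) - 2 * q * e := by rw [he]; ring
    rw [h4]
    have h5 : 2 * q * e = 2 * q ^ 2 * D := by rw [h3]; ring
    have h6 : v + m ^ 2 = D - |e| := by rw [hDdef]; ring
    rw [h5, h6]
    ring
  have h3 : 0 < (e / D) ^ 2 * (D + |e|) := by
    have : e / D ≠ 0 := div_ne_zero hne hD.ne'
    have := abs_nonneg e
    positivity
  linarith

theorem mul_sq_le_of_forall_le {d v m : ℝ} (hd1 : d ≤ 1) (hm : 0 ≤ m)
    (h : ∀ a, 0 ≤ a → d * a ^ 2 ≤ v + (m - a) ^ 2) : d * m ^ 2 ≤ (1 - d) * v := by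
  rcases hd1.lt_or_eq with hlt | rfl
  · have hd : 0 < 1 - d := by linarith
    -- This `a` maximises `d a² - (m - a)²`.
    have h1 := h (m / (1 - d)) (by positivity)
    have h2 : d * (m / (1 - d)) ^ 2 - (m - m / (1 - d)) ^ 2 = d * m ^ 2 / (1 - d) := by
      field_simp; ring
    have h3 : d * m ^ 2 / (1 - d) ≤ v := by linarith
    rw [div_le_iff₀ hd] at h3
    linarith
  · have hm0 : m = 0 := by
      by_contra hne
      have hpos : 0 < m := lt_of_le_of_ne hm (Ne.symm hne)
      -- For `d = 1` the hypothesis reads `2 m a ≤ v + m²`, which fails for large `a` if `m > 0`.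
      have h1 := h ((|v| + m ^ 2 + 1) / m) (by positivity)
      have h2 : (|v| + m ^ 2 + 1) / m * m = |v| + m ^ 2 + 1 := by field_simp
      nlinarith [le_abs_self v, abs_nonneg v]
    simp [hm0]

theorem neg_sq_mul_le {d v m l : ℝ} (hd : 0 < d) (hd1 : d ≤ 1) (hl : 0 ≤ l) (hv : 0 ≤ v)
    (h : 0 ≤ m → d * m ^ 2 ≤ (1 - d) * v) : -(l ^ 2 * (1 / d - 1)) ≤ v - 2 * l * m := by
  have hinv : 0 ≤ 1 / d - 1 := by
    have := (le_div_iff₀ hd).2 ((one_mul d).trans_le hd1)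
    linarith
  rcases lt_or_ge m 0 with hm | hm
  · have : 0 ≤ l ^ 2 * (1 / d - 1) := by positivity
    nlinarith
  · have h1 := h hm
    rcases hd1.lt_or_eq with hlt | rfl
    · have h2 : 0 < 1 - d := by linarith
      have h3 : d * m ^ 2 / (1 - d) ≤ v := (div_le_iff₀ h2).2 (by linarith)
      have h4 : d * m ^ 2 / (1 - d) - 2 * l * m + l ^ 2 * (1 / d - 1) =
          (d * m - l * (1 - d)) ^ 2 / (d * (1 - d)) := by
        field_simp; ring
      have h5 : 0 ≤ (d * m - l * (1 - d)) ^ 2 / (d * (1 - d)) := by positivity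
      linarith
    · have hm0 : m = 0 := by
        have : m ^ 2 = 0 := le_antisymm (by linarith) (sq_nonneg m)
        exact pow_eq_zero_iff two_ne_zero |>.1 this
      simp [hm0, hv]

end Quadratic

theorem lintegral_sub_const_sq {Ω : Type*} [MeasurableSpace Ω] {μ : Measure Ω}
    [IsProbabilityMeasure μ] {X : Ω → ℝ} (hX : MemLp X 2 μ) (γ : ℝ) :
    ∫⁻ ω, ENNReal.ofReal ((X ω - γ) ^ 2) ∂μ =
      ENNReal.ofReal (variance X μ + ((∫ ω, X ω ∂μ) - γ) ^ 2) := by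
  have hs : MemLp (fun ω => X ω - γ) 2 μ := hX.sub (memLp_const γ)
  have h := variance_eq_sub hs
  rw [variance_sub_const hX.aestronglyMeasurable,
    integral_sub (hX.integrable one_le_two) (integrable_const _)] at h
  simp only [Pi.pow_apply, integral_const, probReal_univ, one_smul] at h
  rw [← ofReal_integral_eq_lintegral_ofReal hs.integrable_sq (ae_of_all _ fun ω => sq_nonneg _), h,
    sub_add_cancel]

/-! ### Moments, optimality and the efficient frontier. -/

namespace FactorMarket

variable {Ω : Type*} [MeasurableSpace Ω] {μ : Measure Ω} {T N Ns Nξ : ℕ}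
  {M : FactorMarket μ T N Ns Nξ} {A : ℕ → Set (Fin N → ℝ)} {x₀ : ℝ} {π : ℕ → Ω → (Fin N → ℝ)}

theorem rho_mul_wealth_smul (α : ℝ) {t : ℕ} (ht : t ≤ T) (ω : Ω) :
    M.rho t * M.wealth x₀ (fun t ω => α • π t ω) t ω =
      M.rho 0 * x₀ + α * (M.rho t * M.wealth x₀ π t ω - M.rho 0 * x₀) := by
  induction t with
  | zero => simp [wealth]
  | succ t ih =>
    have h := ih (by omega)
    rw [M.rho_eq_mul ht] at h
    simp only [wealth, dotProduct_smul, smul_eq_mul]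
    linear_combination h

theorem wealth_smul_terminal (α : ℝ) :
    M.wealth x₀ (fun t ω => α • π t ω) T =
      fun ω => M.rho 0 * x₀ + α * (M.wealth x₀ π T ω - M.rho 0 * x₀) := by
  funext ω
  have h := rho_mul_wealth_smul (M := M) (x₀ := x₀) (π := π) α le_rfl ω
  simpa [rho_terminal] using h

theorem var_nonneg : 0 ≤ M.var x₀ π := variance_nonneg _ _

variable [IsProbabilityMeasure μ]

theorem Admissible.smul (hA : ∀ t < T, (0 : Fin N → ℝ) ∈ A t)
    (hcone : ∀ t < T, ∀ α : ℝ, 0 < α → ∀ k ∈ A t, α • k ∈ A t) (h : M.Admissible A x₀ π)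
    {α : ℝ} (hα : 0 ≤ α) : M.Admissible A x₀ (fun t ω => α • π t ω) := by
  refine ⟨fun t ht => ⟨(h.1 t ht).1.const_smul α, ?_⟩, ?_⟩
  · filter_upwards [(h.1 t ht).2] with ω hω
    rcases hα.eq_or_lt with rfl | hα
    · rw [zero_smul]; exact hA t ht
    · exact hcone t ht α hα _ hω
  · rw [wealth_smul_terminal]
    have hs : MemLp (fun ω => M.wealth x₀ π T ω - M.rho 0 * x₀) 2 μ :=
      h.2.sub (memLp_const (M.rho 0 * x₀))
    exact (memLp_const (M.rho 0 * x₀)).add (hs.const_mul α)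

theorem mean_smul (h : M.Admissible A x₀ π) (α : ℝ) :
    M.mean x₀ (fun t ω => α • π t ω) =
      M.rho 0 * x₀ + α * (M.mean x₀ π - M.rho 0 * x₀) := by
  have hi := h.2.integrable one_le_two
  have hs : Integrable (fun ω => α * (M.wealth x₀ π T ω - M.rho 0 * x₀)) μ :=
    (hi.sub (integrable_const (M.rho 0 * x₀))).const_mul α
  unfold mean
  rw [wealth_smul_terminal]
  rw [integral_add (integrable_const _) hs, integral_const_mul α,
    integral_sub hi (integrable_const _)]
  simp

theorem var_smul (h : M.Admissible A x₀ π) (α : ℝ) :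
    M.var x₀ (fun t ω => α • π t ω) = α ^ 2 * M.var x₀ π := by
  unfold var
  rw [wealth_smul_terminal]
  have h1 : AEStronglyMeasurable (fun ω => α * (M.wealth x₀ π T ω - M.rho 0 * x₀)) μ :=
    (h.2.aestronglyMeasurable.sub aestronglyMeasurable_const).const_mul α
  rw [variance_const_add h1, variance_const_mul, variance_sub_const h.2.aestronglyMeasurable]

theorem admissible_zero (hA : ∀ t < T, (0 : Fin N → ℝ) ∈ A t) :
    M.Admissible A x₀ (fun _ _ => 0) := by
  refine ⟨fun t ht => ⟨measurable_const, ae_of_all _ fun _ => hA t ht⟩, ?_⟩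
  have h := wealth_smul_terminal (M := M) (x₀ := x₀) (π := fun _ _ => 0) 0
  simp only [smul_zero, zero_mul, add_zero] at h
  rw [h]
  exact memLp_const _

theorem mean_zero (hA : ∀ t < T, (0 : Fin N → ℝ) ∈ A t) :
    M.mean x₀ (fun _ _ => 0) = M.rho 0 * x₀ := by
  simpa using mean_smul (admissible_zero (M := M) (x₀ := x₀) hA) 0

theorem var_zero (hA : ∀ t < T, (0 : Fin N → ℝ) ∈ A t) : M.var x₀ (fun _ _ => 0) = 0 := by
  simpa using var_smul (admissible_zero (M := M) (x₀ := x₀) hA) 0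

/-- The initial state is deterministic, so an almost sure statement holds at `s₀` itself. -/
theorem dMinus_zero_pos (hM : M.NondegenerateReturns) (hA : ∀ t < T, (0 : Fin N → ℝ) ∈ A t) :
    0 < M.dMinus A 0 M.s₀ := by
  obtain ⟨ω, hω⟩ := (ae_of_ae_map (M.measurable_state (Nat.zero_le T)).aemeasurable
    (regularWeights hM hA (Nat.zero_le T)).minus_pos).exists
  rwa [M.s_zero] at hω

theorem dMinus_zero_le_one (hM : M.NondegenerateReturns) (hA : ∀ t < T, (0 : Fin N → ℝ) ∈ A t) :
    M.dMinus A 0 M.s₀ ≤ 1 :=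
  (regularWeights hM hA (Nat.zero_le T)).minus_le_one _

/-- Lower bound on the mean squared distance of the terminal wealth to a target. -/
theorem dMinus_mul_sq_le (hM : M.NondegenerateReturns) (hA : ∀ t < T, (0 : Fin N → ℝ) ∈ A t)
    (hcone : ∀ t < T, ∀ α : ℝ, 0 < α → ∀ k ∈ A t, α • k ∈ A t) (h : M.Admissible A x₀ π)
    {a : ℝ} (ha : 0 ≤ a) :
    M.dMinus A 0 M.s₀ * a ^ 2 ≤ M.var x₀ π + ((M.mean x₀ π - M.rho 0 * x₀) - a) ^ 2 := by
  have h1 := expectedValue_zero_le_terminal hM hA hcone (M.rho 0 * x₀ + a) h le_rfl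
  rw [expectedValue_zero, expectedValue_terminal, value_of_nonpos (by linarith),
    lintegral_sub_const_sq h.2,
    ENNReal.ofReal_le_ofReal_iff (add_nonneg (variance_nonneg _ _) (sq_nonneg _))] at h1
  unfold var mean
  calc M.dMinus A 0 M.s₀ * a ^ 2 = (M.rho 0 * x₀ - (M.rho 0 * x₀ + a)) ^ 2 * M.dMinus A 0 M.s₀ := by
        ring
    _ ≤ _ := h1
    _ = _ := by ring

theorem dMinus_mul_mean_sq_le (hM : M.NondegenerateReturns)
    (hA : ∀ t < T, (0 : Fin N → ℝ) ∈ A t)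
    (hcone : ∀ t < T, ∀ α : ℝ, 0 < α → ∀ k ∈ A t, α • k ∈ A t) (h : M.Admissible A x₀ π)
    (hm : 0 ≤ M.mean x₀ π - M.rho 0 * x₀) :
    M.dMinus A 0 M.s₀ * (M.mean x₀ π - M.rho 0 * x₀) ^ 2 ≤
      (1 - M.dMinus A 0 M.s₀) * M.var x₀ π :=
  mul_sq_le_of_forall_le (dMinus_zero_le_one hM hA) hm fun _ ha =>
    dMinus_mul_sq_le hM hA hcone h ha

section OptimalPolicy

variable {lam : ℝ} {km kp : ℕ → (Fin Ns → ℝ) → (Fin N → ℝ)}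

theorem lintegral_sq_optPolicy (hM : M.NondegenerateReturns)
    (hA : ∀ t < T, (0 : Fin N → ℝ) ∈ A t) (hk : M.IsAllocation A km kp) (hlam : 0 ≤ lam)
    {d : ℝ} (hd : d = M.dMinus A 0 M.s₀) :
    ∫⁻ ω, ENNReal.ofReal ((M.wealth x₀ (M.feedbackPortfolio x₀ (M.optPolicy x₀ lam d km kp)) T ω -
      (M.rho 0 * x₀ + lam / d)) ^ 2) ∂μ = ENNReal.ofReal (lam ^ 2 / d) := by
  have hpos : 0 < d := hd ▸ dMinus_zero_pos hM hA
  have hy : 0 ≤ lam / d := by positivity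
  rw [← expectedValue_terminal (A := A), expectedValue_optPolicy hM hpos.ne' hA hk le_rfl,
    expectedValue_zero, value_of_nonpos (by linarith), ← hd]
  congr 1
  field_simp
  ring

/-- Square integrability is a consequence of the value identity, whose right side `λ²/d` is finite.
-/
theorem admissible_optPolicy (hM : M.NondegenerateReturns)
    (hA : ∀ t < T, (0 : Fin N → ℝ) ∈ A t)
    (hcone : ∀ t < T, ∀ α : ℝ, 0 < α → ∀ k ∈ A t, α • k ∈ A t)
    (hk : M.IsAllocation A km kp) (hlam : 0 ≤ lam) {d : ℝ} (hd : d = M.dMinus A 0 M.s₀) :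
    M.Admissible A x₀ (M.feedbackPortfolio x₀ (M.optPolicy x₀ lam d km kp)) := by
  have hpos : 0 < d := hd ▸ dMinus_zero_pos hM hA
  refine ⟨fun t ht => ⟨measurable_feedbackPortfolio hk ht,
    feedbackPortfolio_mem hpos.ne' hA hcone hk ht⟩, ?_⟩
  set X := M.wealth x₀ (M.feedbackPortfolio x₀ (M.optPolicy x₀ lam d km kp)) T with hX
  have hXm : Measurable X :=
    (M.measurable_wealth (fun t ht => measurable_feedbackPortfolio hk ht) le_rfl).mono
      (M.ℱ.le T) le_rfl
  have hYm : Measurable fun ω => X ω - (M.rho 0 * x₀ + lam / d) := hXm.sub_const _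
  have hY : MemLp (fun ω => X ω - (M.rho 0 * x₀ + lam / d)) 2 μ := by
    rw [memLp_two_iff_integrable_sq hYm.aestronglyMeasurable]
    refine ⟨(hYm.pow_const 2).aestronglyMeasurable, ?_⟩
    rw [hasFiniteIntegral_iff_ofReal (ae_of_all _ fun ω => sq_nonneg _),
      lintegral_sq_optPolicy hM hA hk hlam hd]
    exact ENNReal.ofReal_lt_top
  have := hY.add (memLp_const (M.rho 0 * x₀ + lam / d))
  refine this.ae_eq (ae_of_all _ fun ω => ?_)
  simp

theorem mean_var_optPolicy (hM : M.NondegenerateReturns)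
    (hA : ∀ t < T, (0 : Fin N → ℝ) ∈ A t)
    (hcone : ∀ t < T, ∀ α : ℝ, 0 < α → ∀ k ∈ A t, α • k ∈ A t)
    (hk : M.IsAllocation A km kp) (hlam : 0 ≤ lam) {d : ℝ} (hd : d = M.dMinus A 0 M.s₀)
    (hπ : π = M.feedbackPortfolio x₀ (M.optPolicy x₀ lam d km kp)) :
    M.mean x₀ π = M.rho 0 * x₀ + lam * (1 / d - 1) ∧ M.var x₀ π = lam ^ 2 * (1 / d - 1) := by
  have hpos : 0 < d := hd ▸ dMinus_zero_pos hM hA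
  have hadm : M.Admissible A x₀ π := hπ ▸ admissible_optPolicy hM hA hcone hk hlam hd
  have ha : 0 ≤ lam / d := by positivity
  have hval := lintegral_sq_optPolicy (x₀ := x₀) hM hA hk hlam hd
  rw [← hπ, lintegral_sub_const_sq hadm.2, ENNReal.ofReal_eq_ofReal_iff
    (add_nonneg (variance_nonneg _ _) (sq_nonneg _)) (by positivity)] at hval
  change M.var x₀ π + (M.mean x₀ π - (M.rho 0 * x₀ + lam / d)) ^ 2 = lam ^ 2 / d at hval
  set m := M.mean x₀ π - M.rho 0 * x₀ with hm
  set v := M.var x₀ π with hv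
  have hda : d * (lam / d) ^ 2 = lam ^ 2 / d := by field_simp
  have hval' : v + (m - lam / d) ^ 2 = lam ^ 2 / d := by
    rw [← hval, hm]; ring
  -- Each scaled portfolio is admissible, so the lower bound at `a = λ/d` applies to it, and that
  -- bound is attained at `α = 1`.
  have hfoc : v + m * (m - lam / d) = 0 := by
    refine add_mul_sub_eq_zero_of_scaling_le var_nonneg fun α hα => ?_
    have h1 := dMinus_mul_sq_le hM hA hcone (hadm.smul hA hcone hα) ha
    rw [mean_smul hadm, var_smul hadm, ← hd, hda] at h1
    rw [hval']
    simpa using h1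
  have hla : lam = lam / d * d := by field_simp
  have hm' : m = lam * (1 / d - 1) := by
    -- Subtracting the two equations leaves a factor `λ/d`; it can be cancelled only when `λ > 0`.
    rcases ha.eq_or_lt with h0 | h0
    · have hl0 : lam = 0 := by rw [hla, ← h0, zero_mul]
      have h1 : v + m ^ 2 = 0 := by
        rw [hl0] at hval'; simpa using hval'
      have h2 : m ^ 2 = 0 := by
        have : 0 ≤ v := var_nonneg
        exact le_antisymm (by linarith) (sq_nonneg m)
      rw [hl0, zero_mul]
      exact pow_eq_zero_iff two_ne_zero |>.1 h2
    · have h1 : lam / d * (m - (lam / d - lam)) = 0 := by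
        have : lam ^ 2 / d = lam / d * lam := by ring
        rw [this] at hval'
        linear_combination hfoc - hval'
      have h2 := (mul_eq_zero.1 h1).resolve_left h0.ne'
      have h3 : lam / d = lam * (1 / d) := by ring
      linear_combination h2 + h3
  refine ⟨by linarith, ?_⟩
  rw [hm'] at hfoc
  have h3 : lam / d = lam * (1 / d) := by ring
  rw [h3] at hfoc
  linear_combination hfoc

/-- The policy attains equality in `d m² ≤ (1 - d) v`, so a pair with no smaller mean and no larger
variance is squeezed onto it. -/
theorem mem_efficientFrontier_optPolicy (hM : M.NondegenerateReturns)
    (hA : ∀ t < T, (0 : Fin N → ℝ) ∈ A t)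
    (hcone : ∀ t < T, ∀ α : ℝ, 0 < α → ∀ k ∈ A t, α • k ∈ A t)
    (hk : M.IsAllocation A km kp) (hlam : 0 ≤ lam) {d : ℝ} (hd : d = M.dMinus A 0 M.s₀)
    (hπ : π = M.feedbackPortfolio x₀ (M.optPolicy x₀ lam d km kp)) :
    (M.mean x₀ π, M.var x₀ π) ∈ M.efficientFrontier A x₀ := by
  have hpos : 0 < d := hd ▸ dMinus_zero_pos hM hA
  have hle : d ≤ 1 := hd ▸ dMinus_zero_le_one hM hA
  have hinv : 0 ≤ 1 / d - 1 := by
    have := (le_div_iff₀ hpos).2 ((one_mul d).trans_le hle)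
    linarith
  have hadm : M.Admissible A x₀ π := hπ ▸ admissible_optPolicy hM hA hcone hk hlam hd
  obtain ⟨hmean, hvar⟩ := mean_var_optPolicy hM hA hcone hk hlam hd hπ
  refine ⟨⟨π, hadm, rfl⟩, ?_⟩
  rintro _ ⟨π', hadm', rfl⟩ h1 h2
  simp only at h1 h2
  have hl : 0 ≤ lam * (1 / d - 1) := by positivity
  have hb := dMinus_mul_mean_sq_le hM hA hcone hadm' (by linarith)
  rw [← hd] at hb
  set m' := M.mean x₀ π' - M.rho 0 * x₀ with hm'
  have hmm : lam * (1 / d - 1) ≤ m' := by linarith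
  have hcurve : (1 - d) * (lam ^ 2 * (1 / d - 1)) = d * (lam * (1 / d - 1)) ^ 2 := by
    field_simp
  have hsq : (lam * (1 / d - 1)) ^ 2 ≤ m' ^ 2 := pow_le_pow_left₀ hl hmm 2
  have hsq' : m' ^ 2 ≤ (lam * (1 / d - 1)) ^ 2 := by
    refine le_of_mul_le_mul_left ?_ hpos
    rw [← hcurve, ← hvar]
    exact hb.trans (mul_le_mul_of_nonneg_left h2 (by linarith))
  have hmeq : m' = lam * (1 / d - 1) :=
    le_antisymm (le_of_sq_le_sq hsq' hl) hmm
  have hveq : M.var x₀ π' = M.var x₀ π := by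
    refine le_antisymm h2 ?_
    rcases hle.lt_or_eq with hlt | h1'
    · refine le_of_mul_le_mul_left (a := 1 - d) ?_ (by linarith)
      rw [hvar, hcurve, ← hmeq]
      exact hb
    · rw [hvar, h1']; simpa using var_nonneg
  have hmeq' : M.mean x₀ π' = M.mean x₀ π := by linarith
  rw [hveq, hmeq']

theorem isOptimal_optPolicy (hM : M.NondegenerateReturns)
    (hA : ∀ t < T, (0 : Fin N → ℝ) ∈ A t)
    (hcone : ∀ t < T, ∀ α : ℝ, 0 < α → ∀ k ∈ A t, α • k ∈ A t)
    (hk : M.IsAllocation A km kp) (hlam : 0 ≤ lam) {d : ℝ} (hd : d = M.dMinus A 0 M.s₀)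
    (hπ : π = M.feedbackPortfolio x₀ (M.optPolicy x₀ lam d km kp)) :
    M.IsOptimal A x₀ lam π := by
  have hpos : 0 < d := hd ▸ dMinus_zero_pos hM hA
  have hle : d ≤ 1 := hd ▸ dMinus_zero_le_one hM hA
  obtain ⟨hmean, hvar⟩ := mean_var_optPolicy hM hA hcone hk hlam hd hπ
  refine ⟨hπ ▸ admissible_optPolicy hM hA hcone hk hlam hd, fun π' hadm' => ?_⟩
  have h := neg_sq_mul_le hpos hle hlam (var_nonneg (M := M) (x₀ := x₀) (π := π'))
    fun hm => hd ▸ dMinus_mul_mean_sq_le hM hA hcone hadm' hm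
  rw [hmean, hvar]
  linarith

theorem efficientFrontier_eq (hM : M.NondegenerateReturns)
    (hA : ∀ t < T, (0 : Fin N → ℝ) ∈ A t)
    (hcone : ∀ t < T, ∀ α : ℝ, 0 < α → ∀ k ∈ A t, α • k ∈ A t)
    (hk : M.IsAllocation A km kp) {d : ℝ} (hd : d = M.dMinus A 0 M.s₀) (hlt : d < 1) :
    M.efficientFrontier A x₀ = {p : ℝ × ℝ | M.rho 0 * x₀ ≤ p.1 ∧
      p.2 = d * (p.1 - M.rho 0 * x₀) ^ 2 / (1 - d)} := by
  have hpos : 0 < d := hd ▸ dMinus_zero_pos hM hA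
  have hlt' : 0 < 1 - d := by linarith
  have hcurve : ∀ m, M.rho 0 * x₀ ≤ m →
      (m, d * (m - M.rho 0 * x₀) ^ 2 / (1 - d)) ∈ M.efficientFrontier A x₀ := by
    intro m hm
    -- The multiplier `λ` whose policy has mean `m`, from `m - ρ₀x₀ = λ(1/d - 1)`.
    have hl : 0 ≤ (m - M.rho 0 * x₀) * d / (1 - d) :=
      div_nonneg (mul_nonneg (by linarith) hpos.le) hlt'.le
    have h1 := mem_efficientFrontier_optPolicy (x₀ := x₀) hM hA hcone hk hl hd rfl
    obtain ⟨h2, h3⟩ := mean_var_optPolicy (x₀ := x₀) hM hA hcone hk hl hd rfl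
    rw [h2, h3] at h1
    convert h1 using 2
    · field_simp
      ring
    · field_simp
  ext ⟨m, v⟩
  constructor
  · rintro ⟨hatt, hmax⟩
    have hv : 0 ≤ v := by
      obtain ⟨π', _, h⟩ := hatt
      rw [(Prod.mk.inj h).2]
      exact var_nonneg
    have hm : M.rho 0 * x₀ ≤ m := by
      by_contra hlt
      -- A mean below `ρ₀x₀` is dominated by holding only the risk-free asset.
      have h := hmax (M.mean x₀ (fun _ _ => 0), M.var x₀ (fun _ _ => 0))
        ⟨_, admissible_zero hA, rfl⟩ (by simpa [mean_zero hA] using (not_le.1 hlt).le)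
        (by simpa [var_zero hA] using hv)
      rw [mean_zero hA] at h
      exact hlt (Prod.mk.inj h).1.le
    refine ⟨hm, ?_⟩
    have hb : d * (m - M.rho 0 * x₀) ^ 2 / (1 - d) ≤ v := by
      obtain ⟨π', hadm, h⟩ := hatt
      obtain ⟨rfl, rfl⟩ := Prod.mk.inj h
      rw [div_le_iff₀ hlt', mul_comm _ (1 - d)]
      exact hd ▸ dMinus_mul_mean_sq_le hM hA hcone hadm (by linarith)
    exact (Prod.mk.inj (hmax _ (hcurve m hm).1 le_rfl hb)).2.symm
  · rintro ⟨hm, hv⟩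
    simp only at hm hv
    rw [hv]
    exact hcurve m hm

end OptimalPolicy

end FactorMarket

end MeanVariance

end

theorem theorem1 {Ω : Type*} [MeasurableSpace Ω] (μ : MeasureTheory.Measure Ω)
    [MeasureTheory.IsProbabilityMeasure μ] {T N Ns Nξ : ℕ}
    (M : MeanVariance.FactorMarket μ T N Ns Nξ) (hM : M.NondegenerateReturns)
    (A : ℕ → Set (Fin N → ℝ))
    (hA_zero : ∀ t < T, (0 : Fin N → ℝ) ∈ A t)
    (hA_cone : ∀ t < T, ∀ α : ℝ, 0 < α → ∀ k ∈ A t, α • k ∈ A t)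
    (x₀ lam : ℝ) (hlam : 0 ≤ lam) :
    -- for closed cones the minimisers exist
    ((∀ t < T, IsClosed (A t)) → ∃ km kp, M.IsAllocation A km kp) ∧
    -- every choice of minimisers yields an optimal policy
    ∀ km kp, M.IsAllocation A km kp →
      ∀ d, d = M.dMinus A 0 M.s₀ →
      ∀ π, π = M.feedbackPortfolio x₀ (M.optPolicy x₀ lam d km kp) →
        (0 < d ∧ d ≤ 1) ∧
        M.IsOptimal A x₀ lam π ∧
        M.mean x₀ π = M.rho 0 * x₀ + lam * (1 / d - 1) ∧
        M.var x₀ π = lam ^ 2 * (1 / d - 1) ∧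
        (M.mean x₀ π, M.var x₀ π) ∈ M.efficientFrontier A x₀ ∧
        (d < 1 →
          M.rho 0 * x₀ ≤ M.mean x₀ π ∧
          M.var x₀ π = d * (M.mean x₀ π - M.rho 0 * x₀) ^ 2 / (1 - d) ∧
          M.efficientFrontier A x₀ =
            {p : ℝ × ℝ | M.rho 0 * x₀ ≤ p.1 ∧
              p.2 = d * (p.1 - M.rho 0 * x₀) ^ 2 / (1 - d)}) := by
  refine ⟨MeanVariance.FactorMarket.exists_isAllocation hM hA_zero, fun km kp hk d hd π hπ => ?_⟩
  have hpos : 0 < d := hd ▸ MeanVariance.FactorMarket.dMinus_zero_pos hM hA_zero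
  have hle : d ≤ 1 := hd ▸ MeanVariance.FactorMarket.dMinus_zero_le_one hM hA_zero
  obtain ⟨hmean, hvar⟩ :=
    MeanVariance.FactorMarket.mean_var_optPolicy hM hA_zero hA_cone hk hlam hd hπ
  refine ⟨⟨hpos, hle⟩,
    MeanVariance.FactorMarket.isOptimal_optPolicy hM hA_zero hA_cone hk hlam hd hπ, hmean, hvar,
    MeanVariance.FactorMarket.mem_efficientFrontier_optPolicy hM hA_zero hA_cone hk hlam hd hπ,
    fun hlt => ?_⟩
  have hlt' : 0 < 1 - d := by linarith
  refine ⟨?_, ?_,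
    MeanVariance.FactorMarket.efficientFrontier_eq hM hA_zero hA_cone hk hd hlt⟩
  · have h : 0 ≤ 1 / d - 1 := by
      have := (le_div_iff₀ hpos).2 ((one_mul d).trans_le hle)
      linarith
    rw [hmean]
    linarith [mul_nonneg hlam h]
  · rw [hvar, hmean]
    field_simp
    ring
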